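/- Let $\mathbb F_q$ be a finite field of characteristic $p$, $A=\mathbb F_q[T]$, $\pi=1/T$, $F_\infty=\mathbb F_q((\pi))$, $O_\infty=\mathbb F_q[[\pi]]$, and let $|\cdot|$ be the absolute value on $F_\infty$ with $|T|=q$. Fix an integer $r\ge 2$ and a nontrivial additive character $\psi_0:\mathbb F_p\to\mathbb C^\times$, and let $\psi:F_\infty\to\mathbb C^\times$, $\psi(\sum_i a_i\pi^i)=\psi_0(\mathrm{Tr}_{\mathbb F_q/\mathbb F_p}(a_1))$. Put $$P(R)=\left\{\begin{pmatrix}1&b\\0&d\end{pmatrix}: b\in R^{r-1},\ d\in \mathrm{GL}_{r-1}(R)\right\},\qquad \Gamma_\infty=\begin{pmatrix}\mathrm{GL}_1(A)&*\\0&\mathrm{GL}_{r-1}(A)\end{pmatrix}\subset \mathrm{GL}_r(A).$$ Let $h:P(F_\infty)\to\mathbb C$ be a function on $\Gamma_\infty\backslash P(F_\infty)/P(O_\infty)$, that is, $h(g')=h(g)$ whenever $g,g'\in P(F_\infty)$ and $g'\in\Gamma_\infty\, g\, P(O_\infty)$. For $\vec x\in F_\infty^{r-1}$ (a row vector) and $y\in\mathrm{GL}_{r-1}(F_\infty)$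 write $h(\vec x,y)=h\begin{pmatrix}1&\vec x y\\0&y\end{pmatrix}$, and for $\vec a\in A^{r-1}$ let $$h^*(\vec a,y)=\int_{A^{r-1}\backslash F_\infty^{r-1}}h(\vec u,y)\,\psi(-\vec a\cdot\vec u)\,d\vec u,$$ where $\vec a\cdot\vec u=\vec a\,\vec u^{\,t}$ and $d\vec u$ is the Haar measure with $\mathrm{vol}((\pi O_\infty)^{r-1})=1$ (and $(\pi O_\infty)^{r-1}$ is a fundamental domain for $A^{r-1}$). For $\vec a=(a_1,\dots,a_{r-1})\in A^{r-1}$ set $y_{\vec a}=\mathrm{diag}(T^{\alpha_1},\dots,T^{\alpha_{r-1}})$ with $\alpha_i=\max(2,\deg(a_i)+2)$ (where $\deg 0=-\infty$), and $$c_{\vec a}(h)=|\det y_{\vec a}|\cdot q^{2(1-r)}\cdot h^*(\vec a,y_{\vec a}).$$ Then $h$ satisfies the harmonicity relation $$\sum_{\vec u\in\mathbb F_q^{s-1}}h\left(g\begin{pmatrix}1&T\vec u&0\\&T I_{s-1}&\\&&T I_{r-s}\end{pmatrix}\right)=h\left(g\begin{pmatrix}I_s&\\&T I_{r-s}\end{pmatrix}\right)\qquad\text{for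 all } g\in P(F_\infty),\ 1\le s\le r,$$ if and only if for all $y\in\mathrm{GL}_{r-1}(F_\infty)$ and all $\vec a\in A^{r-1}$ with $\vec a(y^t)^{-1}\in(\pi^2O_\infty)^{r-1}$ one has $$h^*(\vec a,y)=|\det y|^{-1}\cdot q^{2(r-1)}\cdot c_{\vec a}(h).$$ In this case, for every $y\in\mathrm{GL}_{r-1}(F_\infty)$ the set of $\vec a\in A^{r-1}$ with $\vec a(y^t)^{-1}\in(\pi^2O_\infty)^{r-1}$ is finite, and for all $\vec x\in F_\infty^{r-1}$ $$h(\vec x,y)=|\det y|^{-1}\cdot q^{2(r-1)}\sum_{\substack{\vec a\in A^{r-1}\\ \vec a(y^t)^{-1}\in(\pi^2O_\infty)^{r-1}}}c_{\vec a}(h)\,\psi(\vec a\cdot\vec x).$$ -/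

import Mathlib

open MeasureTheory Polynomial
open scoped Matrix MatrixGroups

noncomputable section

namespace DrinfeldFourier

/-- `F_∞ = 𝔽_q((π))` with `π = 1/T`, i.e. the field of Laurent series in `1/T`; it carries the
`π`-adic topology (Mathlib's instance). -/
abbrev FInf (Fq : Type*) [Field Fq] : Type _ := LaurentSeries Fq

section Field

variable (Fq : Type*) [Field Fq]

/-- The element `T = π⁻¹` of `F_∞ˣ`. -/
def tUnit : (FInf Fq)ˣ :=
  Units.mk0 (HahnSeries.single (-1 : ℤ) (1 : Fq)) (HahnSeries.single_ne_zero one_ne_zero)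

/-- The embedding of `A = 𝔽_q[T]` into `F_∞`. -/
def polyEmb : Fq[X] →+* FInf Fq :=
  Polynomial.eval₂RingHom HahnSeries.C (tUnit Fq : FInf Fq)

/-- The embedding of `O_∞ = 𝔽_q[[π]]` into `F_∞`. -/
def intEmb : PowerSeries Fq →+* FInf Fq := HahnSeries.ofPowerSeries ℤ Fq

/-- `π^k O_∞`, the series `∑ aᵢ πⁱ` with `aᵢ = 0` for `i < k`. -/
def piO (k : ℤ) : AddSubgroup (FInf Fq) where
  carrier := {f | ∀ n < k, f.coeff n = 0}
  zero_mem' := by intro n _; simp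
  add_mem' := by
    intro a b ha hb n hn
    simp [ha n hn, hb n hn]
  neg_mem' := by
    intro a ha n hn
    simp [ha n hn]

/-- `(π^k O_∞)^n`. -/
def polydisc (k : ℤ) (n : ℕ) : Set (Fin n → FInf Fq) :=
  Set.univ.pi fun _ => (piO Fq k : Set (FInf Fq))

/-- The lattice `A^n` in `F_∞^n`. -/
def lattice (n : ℕ) : AddSubgroup (Fin n → FInf Fq) where
  carrier := {v | ∃ a : Fin n → Fq[X], ∀ i, v i = polyEmb Fq (a i)}
  zero_mem' := ⟨0, by simp⟩
  add_mem' := by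
    rintro v w ⟨a, ha⟩ ⟨b, hb⟩
    exact ⟨a + b, fun i => by simp [ha, hb]⟩
  neg_mem' := by
    rintro v ⟨a, ha⟩
    exact ⟨-a, fun i => by simp [ha]⟩

variable {Fq}

theorem mem_piO {k : ℤ} {f : FInf Fq} : f ∈ piO Fq k ↔ ∀ n < k, f.coeff n = 0 := Iff.rfl

theorem coeff_single_mul_intEmb (k n : ℤ) (z : PowerSeries Fq) :
    (HahnSeries.single k (1 : Fq) * intEmb Fq z).coeff n =
      if k ≤ n then PowerSeries.coeff (n - k).toNat z else 0 := by
  have h : (HahnSeries.single k (1 : Fq) * intEmb Fq z).coeff (n - k + k) =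
      (intEmb Fq z).coeff (n - k) := by
    rw [HahnSeries.coeff_single_mul_add, one_mul]
  rw [sub_add_cancel] at h
  rw [h, intEmb, PowerSeries.coeff_coe]
  by_cases hk : k ≤ n
  · rw [if_neg (by omega), if_pos hk]
    congr 2
    omega
  · rw [if_pos (by omega), if_neg hk]

/-- `piO Fq k` is `π^k` times the ring of power series. -/
theorem mem_piO_iff_exists {k : ℤ} {f : FInf Fq} :
    f ∈ piO Fq k ↔ ∃ z : PowerSeries Fq, f = HahnSeries.single k (1 : Fq) * intEmb Fq z := by
  constructor
  · intro hf
    refine ⟨PowerSeries.mk fun n => f.coeff (k + n), ?_⟩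
    ext n
    rw [coeff_single_mul_intEmb]
    split_ifs with h
    · rw [PowerSeries.coeff_mk]
      congr 1
      omega
    · exact hf n (by omega)
  · rintro ⟨z, rfl⟩ n hn
    rw [coeff_single_mul_intEmb, if_neg (by omega)]

theorem mem_piO_iff_val {k : ℤ} {f : FInf Fq} :
    f ∈ piO Fq k ↔ Valued.v f ≤ WithZero.exp (-k) :=
  (LaurentSeries.valuation_le_iff_coeff_lt_eq_zero Fq).symm

/-- The sets `π^k O_∞` are neighbourhoods of `0` and every neighbourhood contains one. -/
theorem exists_piO_subset {f : FInf Fq} {U : Set (FInf Fq)} (hU : U ∈ nhds f) :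
    ∃ k : ℤ, ∀ g, g - f ∈ piO Fq k → g ∈ U := by
  obtain ⟨γ, hγ⟩ := Valued.mem_nhds.mp hU
  refine ⟨-(WithZero.log (MonoidWithZeroHom.ValueGroup₀.embedding γ.1) - 1), fun g hg => hγ ?_⟩
  rw [mem_piO_iff_val] at hg
  simp only [Set.mem_ofPred_eq]
  rw [Valuation.restrict_lt_iff_lt_embedding]
  refine lt_of_le_of_lt hg ?_
  rw [← WithZero.lt_log_iff_exp_lt (by simp)]
  simp

theorem isOpen_piO (k : ℤ) : IsOpen (piO Fq k : Set (FInf Fq)) := by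
  have h0 : IsOpen (piO Fq 0 : Set (FInf Fq)) := by
    have : (piO Fq 0 : Set (FInf Fq)) =
        ((Valued.v : Valuation (FInf Fq) _).integer : Set (FInf Fq)) := by
      ext f
      rw [SetLike.mem_coe, mem_piO_iff_val]
      simp [Valuation.mem_integer_iff]
    rw [this]
    exact Valued.isOpen_integer _
  have : (piO Fq k : Set (FInf Fq)) =
      (fun f : FInf Fq => HahnSeries.single (-k) (1 : Fq) * f) ⁻¹' (piO Fq 0) := by
    ext f
    simp only [SetLike.mem_coe, mem_piO, Set.mem_preimage]
    have h : ∀ n, (HahnSeries.single (-k) (1 : Fq) * f).coeff n = f.coeff (n + k) := by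
      intro n
      have := HahnSeries.coeff_single_mul_add (r := (1 : Fq)) (x := f) (a := n + k) (b := -k)
      rwa [one_mul, add_neg_cancel_right] at this
    simp only [h]
    exact ⟨fun hf n hn => hf _ (by omega), fun hf n hn => by
      simpa using hf (n - k) (by omega)⟩
  rw [this]
  exact h0.preimage (continuous_const.mul continuous_id)

theorem isCompact_piO [Finite Fq] (k : ℤ) : IsCompact (piO Fq k : Set (FInf Fq)) := by
  let _ : TopologicalSpace Fq := ⊥
  have : DiscreteTopology Fq := ⟨rfl⟩
  let Φ : (ℕ → Fq) → FInf Fq := fun a =>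
    HahnSeries.single k (1 : Fq) * intEmb Fq (PowerSeries.mk a)
  have hΦ : ∀ a n, (Φ a).coeff n = if k ≤ n then a (n - k).toNat else 0 := by
    intro a n
    simp only [Φ, coeff_single_mul_intEmb, PowerSeries.coeff_mk]
  have hr : (piO Fq k : Set (FInf Fq)) = Set.range Φ := by
    ext f
    rw [SetLike.mem_coe, mem_piO_iff_exists]
    constructor
    · rintro ⟨z, rfl⟩
      refine ⟨fun n => PowerSeries.coeff n z, ?_⟩
      simp only [Φ]
      congr 2
      ext n
      simp
    · rintro ⟨a, rfl⟩
      exact ⟨_, rfl⟩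
  rw [hr]
  refine isCompact_range (continuous_iff_continuousAt.2 fun a U hU => ?_)
  obtain ⟨m, hm⟩ := exists_piO_subset hU
  have : {b : ℕ → Fq | ∀ i ∈ Finset.range (m - k).toNat, b i = a i} ∈ nhds a := by
    refine IsOpen.mem_nhds ?_ (fun _ _ => rfl)
    have : {b : ℕ → Fq | ∀ i ∈ Finset.range (m - k).toNat, b i = a i}
        = ⋂ i ∈ Finset.range (m - k).toNat, (fun b : ℕ → Fq => b i) ⁻¹' {a i} := by
      ext b; simp
    rw [this]
    exact isOpen_biInter_finset fun i _ => (isOpen_discrete _).preimage (continuous_apply i)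
  refine Filter.mem_map.2 (Filter.mem_of_superset this fun b hb => hm _ fun n hn => ?_)
  rw [HahnSeries.coeff_sub, hΦ, hΦ]
  split_ifs with h
  · rw [hb _ (by simp; omega), sub_self]
  · simp

theorem coeff_polyEmb (p : Fq[X]) (n : ℤ) :
    (polyEmb Fq p).coeff n = if n ≤ 0 then p.coeff (-n).toNat else 0 := by
  induction p using Polynomial.induction_on' with
  | add p q hp hq =>
    rw [map_add, HahnSeries.coeff_add, hp, hq]
    split_ifs <;> simp
  | monomial j a =>
    have : polyEmb Fq (monomial j a) = HahnSeries.single (-(j : ℤ)) a := by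
      simp [polyEmb, tUnit, HahnSeries.single_pow, HahnSeries.C_apply, HahnSeries.single_mul_single]
    rw [this, HahnSeries.coeff_single, Polynomial.coeff_monomial]
    split_ifs <;> first | rfl | omega

theorem exists_polyEmb_add_mem (f : FInf Fq) : ∃ p : Fq[X], polyEmb Fq p + f ∈ piO Fq 1 := by
  refine ⟨-∑ m ∈ Finset.range ((-f.order).toNat + 1), monomial m (f.coeff (-(m : ℤ))),
    fun n hn => ?_⟩
  rw [HahnSeries.coeff_add, coeff_polyEmb, if_pos (by omega), Polynomial.coeff_neg,
    Polynomial.finsetSum_coeff]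
  simp only [Polynomial.coeff_monomial, Finset.sum_ite_eq', Finset.mem_range]
  split_ifs with h
  · rw [show (-(((-n).toNat : ℕ) : ℤ)) = n by omega]
    simp
  · rw [HahnSeries.coeff_eq_zero_of_lt_order (by omega)]
    simp

theorem polyEmb_mem_piO {p : Fq[X]} (hp : polyEmb Fq p ∈ piO Fq 1) : p = 0 := by
  ext m
  have := hp (-(m : ℤ)) (by omega)
  rw [coeff_polyEmb, if_pos (by omega)] at this
  simpa using this

variable (Fq)

instance instMeasurableSpaceFInfVec (n : ℕ) : MeasurableSpace (Fin n → FInf Fq) := borel _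

instance instBorelSpaceFInfVec (n : ℕ) : BorelSpace (Fin n → FInf Fq) := ⟨rfl⟩

theorem isOpen_polydisc (k : ℤ) (n : ℕ) : IsOpen (polydisc Fq k n) :=
  isOpen_set_pi Set.finite_univ fun _ _ => isOpen_piO k

/-- The compact open subgroup `(π O_∞)^n`. -/
def polydiscCompacts [Finite Fq] (n : ℕ) : TopologicalSpace.PositiveCompacts (Fin n → FInf Fq) where
  carrier := polydisc Fq 1 n
  isCompact' := isCompact_univ_pi fun _ => isCompact_piO 1
  interior_nonempty' := by
    rw [(isOpen_polydisc Fq 1 n).interior_eq]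
    exact ⟨0, fun _ _ => (piO Fq 1).zero_mem⟩

/-- The Haar measure on `F_∞^n` with `vol((π O_∞)^n) = 1`. -/
def haarF [Finite Fq] (n : ℕ) : Measure (Fin n → FInf Fq) :=
  Measure.addHaarMeasure (polydiscCompacts Fq n)

/-- `(π O_∞)^n` is a fundamental domain for translation by `A^n` on `F_∞^n`. -/
theorem isAddFundamentalDomain_polydisc [Finite Fq] (n : ℕ) :
    IsAddFundamentalDomain (lattice Fq n) (polydisc Fq 1 n) (haarF Fq n) := by
  refine IsAddFundamentalDomain.mk' (isOpen_polydisc Fq 1 n).measurableSet.nullMeasurableSet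
    fun x => ?_
  choose p hp using fun i => exists_polyEmb_add_mem (x i)
  refine ⟨⟨fun i => polyEmb Fq (p i), p, fun _ => rfl⟩, fun i _ => hp i, ?_⟩
  rintro ⟨v, a, ha⟩ hv
  refine Subtype.ext (funext fun i => ?_)
  have h1 : v i + x i ∈ piO Fq 1 := hv i (Set.mem_univ i)
  rw [ha i] at h1
  have h2 := (piO Fq 1).sub_mem h1 (hp i)
  rw [add_sub_add_right_eq_sub, ← map_sub] at h2
  simp only [ha i]
  rw [sub_eq_zero.1 (polyEmb_mem_piO h2)]

end Field

section Groups

variable {R : Type*} [CommRing R]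

theorem fromBlocks_row_mul {n : ℕ} (e e' : R) (b b' : Fin n → R) (d d' : Matrix (Fin n) (Fin n) R) :
    Matrix.fromBlocks (Matrix.of fun _ _ => e : Matrix (Fin 1) (Fin 1) R) (Matrix.of fun _ => b) 0 d *
      Matrix.fromBlocks (Matrix.of fun _ _ => e' : Matrix (Fin 1) (Fin 1) R)
        (Matrix.of fun _ => b') 0 d' =
    Matrix.fromBlocks (Matrix.of fun _ _ => e * e') (Matrix.of fun _ => e • b' + Matrix.vecMul b d')
      0 (d * d') := by
  rw [Matrix.fromBlocks_multiply]
  congr 1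
  · ext i j
    simp [Matrix.mul_apply]
  · ext i j
    simp [Matrix.mul_apply, Matrix.vecMul, dotProduct]
  · simp
  · simp

theorem fromBlocks_row_one {n : ℕ} :
    Matrix.fromBlocks (Matrix.of fun _ _ => (1 : R) : Matrix (Fin 1) (Fin 1) R)
      (Matrix.of fun _ => (0 : Fin n → R)) 0 (1 : Matrix (Fin n) (Fin n) R) = 1 := by
  rw [← Matrix.fromBlocks_one]
  congr 1
  ext i j
  rw [Subsingleton.elim i j]
  simp

/-- The block matrix `(ε b; 0 d)` in `GL_{1+n}(R)`, for a unit `ε`, a row vector `b` and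
`d ∈ GL_n(R)`. -/
def blockGL {n : ℕ} (ε : Rˣ) (b : Fin n → R) (d : GL (Fin n) R) : GL (Fin 1 ⊕ Fin n) R where
  val := Matrix.fromBlocks (Matrix.of fun _ _ => (ε : R)) (Matrix.of fun _ => b) 0 d.val
  inv := Matrix.fromBlocks (Matrix.of fun _ _ => ((ε⁻¹ : Rˣ) : R))
    (Matrix.of fun _ => -(((ε⁻¹ : Rˣ) : R) • Matrix.vecMul b d⁻¹.val)) 0 d⁻¹.val
  val_inv := by
    rw [fromBlocks_row_mul, ← fromBlocks_row_one]
    congr 1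
    · simp
    · simp [smul_smul]
    · simp
  inv_val := by
    rw [fromBlocks_row_mul, ← fromBlocks_row_one]
    congr 1
    · simp
    · rw [Matrix.neg_vecMul, Matrix.smul_vecMul, Matrix.vecMul_vecMul, ← Units.val_mul,
        inv_mul_cancel]
      simp
    · simp

theorem blockGL_mul {n : ℕ} (ε ε' : Rˣ) (b b' : Fin n → R) (d d' : GL (Fin n) R) :
    blockGL ε b d * blockGL ε' b' d' =
      blockGL (ε * ε') ((ε : R) • b' + Matrix.vecMul b d'.val) (d * d') :=
  Units.ext (fromBlocks_row_mul _ _ _ _ _ _)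

theorem blockGL_one {n : ℕ} : blockGL (1 : Rˣ) (0 : Fin n → R) 1 = 1 :=
  Units.ext fromBlocks_row_one

end Groups

section Main

variable (Fq : Type*) [Field Fq] (r : ℕ)

/-- `P(F_∞) = {(1 b; 0 d) : d ∈ GL_{r-1}(F_∞)}`, a subgroup of `GL_r(F_∞)`; the `r` rows and
columns are indexed by `Fin 1 ⊕ Fin (r - 1)`. -/
def PInf : Subgroup (GL (Fin 1 ⊕ Fin (r - 1)) (FInf Fq)) where
  carrier := {g | ∃ b d, g = blockGL 1 b d}
  one_mem' := ⟨0, 1, blockGL_one.symm⟩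
  mul_mem' := by
    rintro _ _ ⟨b, d, rfl⟩ ⟨b', d', rfl⟩
    refine ⟨b' + Matrix.vecMul b d'.val, d * d', ?_⟩
    rw [blockGL_mul]
    simp
  inv_mem' := by
    rintro _ ⟨b, d, rfl⟩
    refine ⟨-Matrix.vecMul b d⁻¹.val, d⁻¹, ?_⟩
    rw [inv_eq_iff_mul_eq_one, blockGL_mul, ← blockGL_one]
    simp

/-- `P(O_∞)`, as a subset of `GL_r(F_∞)`. -/
def PInt : Set (GL (Fin 1 ⊕ Fin (r - 1)) (FInf Fq)) :=
  {κ | ∃ b d, κ = Matrix.GeneralLinearGroup.map (intEmb Fq) (blockGL 1 b d)}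

/-- `Γ_∞ = (GL_1(A) *; 0 GL_{r-1}(A))`, as a subset of `GL_r(F_∞)`. -/
def gammaInf : Set (GL (Fin 1 ⊕ Fin (r - 1)) (FInf Fq)) :=
  {γ | ∃ ε b d, γ = Matrix.GeneralLinearGroup.map (polyEmb Fq) (blockGL ε b d)}

variable {Fq r}

/-- The element `(1 b; 0 d)` of `P(F_∞)`. -/
def pMat (b : Fin (r - 1) → FInf Fq) (d : GL (Fin (r - 1)) (FInf Fq)) : PInf Fq r :=
  ⟨blockGL 1 b d, b, d, rfl⟩

/-- `h` is a function on `Γ_∞ \ P(F_∞) / P(O_∞)`: it takes equal values at any two elements of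
`P(F_∞)` that lie in the same double coset of `Γ_∞` and `P(O_∞)`. -/
def IsDoubleCosetFunction (h : PInf Fq r → ℂ) : Prop :=
  ∀ g g' : PInf Fq r, ∀ γ ∈ gammaInf Fq r, ∀ κ ∈ PInt Fq r,
    (g' : GL (Fin 1 ⊕ Fin (r - 1)) (FInf Fq)) = γ * g * κ → h g' = h g

/-- The invertible diagonal matrix with diagonal entries `v`. -/
def diagGL {n : ℕ} (v : Fin n → (FInf Fq)ˣ) : GL (Fin n) (FInf Fq) where
  val := Matrix.diagonal fun i => (v i : FInf Fq)
  inv := Matrix.diagonal fun i => ((v i)⁻¹ : (FInf Fq)ˣ)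
  val_inv := by simp [Matrix.diagonal_mul_diagonal]
  inv_val := by simp [Matrix.diagonal_mul_diagonal]

/-- The harmonicity relation: for all `g ∈ P(F_∞)` and `1 ≤ s ≤ r`,
`∑_{u ∈ 𝔽_q^{s-1}} h(g (1 (T u, 0); 0 T I_{r-1})) = h(g diag(I_s, T I_{r-s}))`. -/
def IsHarmonic [Fintype Fq] (h : PInf Fq r → ℂ) : Prop :=
  ∀ (g : PInf Fq r) (s : ℕ), 1 ≤ s → s ≤ r →
    ∑ u : Fin (s - 1) → Fq,
      h (g * pMat
        (fun i => if hi : (i : ℕ) < s - 1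
          then (tUnit Fq : FInf Fq) * HahnSeries.C (u ⟨i, hi⟩) else 0)
        (diagGL fun _ => tUnit Fq)) =
    h (g * pMat 0 (diagGL fun i => if (i : ℕ) < s - 1 then 1 else tUnit Fq))

open Classical in
/-- The normalized absolute value on `F_∞`, with `|T| = q`. -/
def absInf [Fintype Fq] (x : FInf Fq) : ℝ :=
  if x = 0 then 0 else (Fintype.card Fq : ℝ) ^ (-x.order)

/-- The additive character `ψ(∑ aᵢ πⁱ) = ψ₀(Tr_{𝔽_q/𝔽_p}(a₁))` of `F_∞`. -/
def psi {p : ℕ} [Algebra (ZMod p) Fq] (ψ₀ : AddChar (ZMod p) ℂ) (x : FInf Fq) : ℂ :=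
  ψ₀ (Algebra.trace (ZMod p) Fq (x.coeff 1))

/-- The dot product `a • x` of `a ∈ A^n` and `x ∈ F_∞^n`. -/
def polyDot {n : ℕ} (a : Fin n → Fq[X]) (x : Fin n → FInf Fq) : FInf Fq :=
  ∑ i, polyEmb Fq (a i) * x i

/-- `h(x, y)`, the value of `h` at `(1 xy; 0 y)`. -/
def valueAt (h : PInf Fq r → ℂ) (x : Fin (r - 1) → FInf Fq) (y : GL (Fin (r - 1)) (FInf Fq)) : ℂ :=
  h (pMat (Matrix.vecMul x y.val) y)

/-- The Fourier coefficient `h^*(a, y)`. The integral over `A^{r-1} \ F_∞^{r-1}` is taken over the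
fundamental domain `(π O_∞)^{r-1}`. -/
def fourierCoeff [Fintype Fq] {p : ℕ} [Algebra (ZMod p) Fq] (ψ₀ : AddChar (ZMod p) ℂ)
    (h : PInf Fq r → ℂ) (a : Fin (r - 1) → Fq[X]) (y : GL (Fin (r - 1)) (FInf Fq)) : ℂ :=
  ∫ u in polydisc Fq 1 (r - 1), valueAt h u y * psi ψ₀ (-polyDot a u) ∂(haarF Fq (r - 1))

/-- `a (yᵗ)⁻¹ ∈ (π² O_∞)^{r-1}`. -/
def Admissible (a : Fin (r - 1) → Fq[X]) (y : GL (Fin (r - 1)) (FInf Fq)) : Prop :=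
  Matrix.vecMul (fun i => polyEmb Fq (a i)) (y.valᵀ)⁻¹ ∈ polydisc Fq 2 (r - 1)

/-- `y_a = diag(T^{α_1}, …, T^{α_{r-1}})` with `α_i = max(2, deg(a_i) + 2)`; the convention for the
degree of the zero polynomial is immaterial here. -/
def yOf (a : Fin (r - 1) → Fq[X]) : GL (Fin (r - 1)) (FInf Fq) :=
  diagGL fun i => tUnit Fq ^ max 2 ((a i).natDegree + 2)

/-- `c_a(h) = |det y_a| q^{2(1-r)} h^*(a, y_a)`. -/
def cCoeff [Fintype Fq] {p : ℕ} [Algebra (ZMod p) Fq] (ψ₀ : AddChar (ZMod p) ℂ)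
    (h : PInf Fq r → ℂ) (a : Fin (r - 1) → Fq[X]) : ℂ :=
  (absInf (yOf a).val.det : ℂ) * (Fintype.card Fq : ℂ) ^ (2 * (1 - (r : ℤ))) *
    fourierCoeff ψ₀ h a (yOf a)

end Main

end DrinfeldFourier

end

/-! Fix `y`. Left unipotents from `Γ_∞` make `x ↦ h(x,y)` periodic under `A^{r-1}`, and right
unipotents from `P(O_∞)` make it invariant under `O_∞^{r-1} y⁻¹`. It is therefore a finite Fourier
series (`IsPeriodic.fourier_inversion`), and since `ψ` is nontrivial on `πO_∞` but trivial on
`π²O_∞`, the coefficient at `a` vanishes unless `a` is admissible for `y` (`fourierCoeff_eq_zero`).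

Write `t_s = diag(I_{s-1}, T I_{r-s})`. In the coordinates `(x,y)` the harmonic sum runs over
translations by `u y⁻¹`, so on Fourier coefficients it becomes a character sum over `𝔽_q^{s-1}`,
equal to `q^{s-1}` or `0`. It survives exactly when admissibility for `y t_1` improves to
admissibility for `y t_s`. Because `|det t_1| = q^{s-1} |det t_s|`, harmonicity says that `H(y) =
|det y| h^*(a,y)` satisfies `H(y t_1) = H(y t_s)` whenever `a` is admissible for `y t_s`
(`isHarmonic_iff_scaledCoeff`).

If `H` is constant on admissible `y`, this relation is immediate. Conversely
(`IsHarmonic.scaledCoeff_eq`), `s = r` gives `H(yT) = H(y)` for admissible `y`, and every `y`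
becomes admissible after multiplication by a high power of the central `T`. So the matrices that
leave `H` unchanged after such a multiplication form a group. It contains `GL_{r-1}(O_∞)` and all
`t_s`, hence everything (`subgroup_eq_top`). The coefficient `c_a` records the constant, since `a`
is admissible for `y_a`. -/

noncomputable section

namespace DrinfeldFourier

/-! ### The additive character `ψ` and its nontriviality. -/

section Character

variable {p : ℕ} {Fq : Type*} [Field Fq] [Algebra (ZMod p) Fq] (ψ₀ : AddChar (ZMod p) ℂ)

theorem psi_zero : psi ψ₀ (0 : FInf Fq) = 1 := by
  simp [psi]

theorem psi_add (x y : FInf Fq) : psi ψ₀ (x + y) = psi ψ₀ x * psi ψ₀ y := by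
  simp [psi, AddChar.map_add_eq_mul]

theorem psi_neg_mul_self (x : FInf Fq) : psi ψ₀ (-x) * psi ψ₀ x = 1 := by
  rw [← psi_add, neg_add_cancel, psi_zero]

theorem psi_ne_zero (x : FInf Fq) : psi ψ₀ x ≠ 0 :=
  right_ne_zero_of_mul_eq_one (psi_neg_mul_self ψ₀ x)

theorem psi_neg (x : FInf Fq) : psi ψ₀ (-x) = (psi ψ₀ x)⁻¹ :=
  eq_inv_of_mul_eq_one_left (psi_neg_mul_self ψ₀ x)

theorem psi_eq_one_of_coeff {x : FInf Fq} (hx : x.coeff 1 = 0) : psi ψ₀ x = 1 := by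
  simp [psi, hx]

theorem psi_eq_one_of_mem_piO {x : FInf Fq} (hx : x ∈ piO Fq 2) : psi ψ₀ x = 1 :=
  psi_eq_one_of_coeff ψ₀ (hx 1 (by norm_num))

theorem psi_polyEmb (a : Fq[X]) : psi ψ₀ (polyEmb Fq a) = 1 :=
  psi_eq_one_of_coeff ψ₀ (by rw [coeff_polyEmb, if_neg (by norm_num)])

variable {ψ₀}

/-- The trace of a finite field is surjective, so a value where `ψ₀` is nontrivial is a trace;
divide a preimage by `x`. -/
theorem exists_trace_mul_ne_one [Fact p.Prime] [Finite Fq] (hψ₀ : ψ₀ ≠ 1) {x : Fq} (hx : x ≠ 0) :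
    ∃ c : Fq, ψ₀ (Algebra.trace (ZMod p) Fq (c * x)) ≠ 1 := by
  obtain ⟨z, hz⟩ := AddChar.ne_one_iff.1 hψ₀
  obtain ⟨w, hw⟩ := Algebra.trace_surjective (ZMod p) Fq z
  exact ⟨w * x⁻¹, by rwa [inv_mul_cancel_right₀ hx, hw]⟩

theorem coeff_single_mul (j n : ℤ) (c : Fq) (f : FInf Fq) :
    (HahnSeries.single j c * f).coeff n = c * f.coeff (n - j) := by
  have := HahnSeries.coeff_single_mul_add (r := c) (x := f) (a := n - j) (b := j)
  rwa [sub_add_cancel] at this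

/-- A series with a nonzero coefficient `aₙ` is moved out of the kernel of `ψ` by multiplication
by some `c π^{1-n}`. -/
theorem exists_psi_single_mul_ne_one [Fact p.Prime] [Finite Fq] (hψ₀ : ψ₀ ≠ 1) {f : FInf Fq}
    {n : ℤ} (hf : f.coeff n ≠ 0) :
    ∃ c : Fq, psi ψ₀ (HahnSeries.single (1 - n) c * f) ≠ 1 := by
  obtain ⟨c, hc⟩ := exists_trace_mul_ne_one hψ₀ hf
  refine ⟨c, ?_⟩
  rwa [psi, coeff_single_mul, sub_sub_cancel]

end Character

/-! ### The filtration `π^k O_∞`, the lattice `A^n` and the pairing between them. -/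

section Integers

variable {Fq : Type*} [Field Fq]

theorem piO_mono {k l : ℤ} (h : k ≤ l) {f : FInf Fq} (hf : f ∈ piO Fq l) : f ∈ piO Fq k :=
  fun n hn => hf n (hn.trans_le h)

theorem mul_mem_piO {k l : ℤ} {f g : FInf Fq} (hf : f ∈ piO Fq k) (hg : g ∈ piO Fq l) :
    f * g ∈ piO Fq (k + l) := by
  obtain ⟨z, rfl⟩ := mem_piO_iff_exists.1 hf
  obtain ⟨w, rfl⟩ := mem_piO_iff_exists.1 hg
  refine mem_piO_iff_exists.2 ⟨z * w, ?_⟩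
  rw [mul_mul_mul_comm, HahnSeries.single_mul_single, one_mul, map_mul]

theorem single_mem_piO (k : ℤ) (c : Fq) : HahnSeries.single k c ∈ piO Fq k :=
  fun _ hn => HahnSeries.coeff_single_of_ne hn.ne

theorem tUnit_val : (tUnit Fq : FInf Fq) = HahnSeries.single (-1) 1 := rfl

theorem tUnit_inv_val : ((tUnit Fq)⁻¹ : (FInf Fq)ˣ).val = HahnSeries.single 1 1 := by
  rw [Units.val_inv_eq_inv_val, tUnit_val, HahnSeries.inv_single]
  simp

theorem tUnit_mem_piO : (tUnit Fq : FInf Fq) ∈ piO Fq (-1) := single_mem_piO _ _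

theorem tUnit_inv_mem_piO : ((tUnit Fq)⁻¹ : (FInf Fq)ˣ).val ∈ piO Fq 1 := by
  rw [tUnit_inv_val]
  exact single_mem_piO _ _

theorem mem_piO_zero_iff {f : FInf Fq} : f ∈ piO Fq 0 ↔ ∃ z, intEmb Fq z = f := by
  rw [mem_piO_iff_exists]
  have : (HahnSeries.single (0 : ℤ) (1 : Fq)) = 1 := rfl
  simp only [this, one_mul, eq_comm]

theorem exists_mem_piO (f : FInf Fq) : ∃ k : ℕ, f ∈ piO Fq (-k) :=
  ⟨(-f.order).toNat, fun _ hn => HahnSeries.coeff_eq_zero_of_lt_order (by omega)⟩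

theorem sum_mem_piO {ι : Type*} (s : Finset ι) {k : ℤ} {f : ι → FInf Fq}
    (hf : ∀ i ∈ s, f i ∈ piO Fq k) : ∑ i ∈ s, f i ∈ piO Fq k :=
  AddSubgroup.sum_mem _ hf

theorem mem_polydisc {n : ℕ} {k : ℤ} {x : Fin n → FInf Fq} :
    x ∈ polydisc Fq k n ↔ ∀ i, x i ∈ piO Fq k := by
  simp [polydisc]

theorem add_mem_polydisc_iff {n : ℕ} {k : ℤ} {x y : Fin n → FInf Fq} (hy : y ∈ polydisc Fq k n) :
    x + y ∈ polydisc Fq k n ↔ x ∈ polydisc Fq k n := by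
  simp only [mem_polydisc]
  exact forall_congr' fun i => (piO Fq k).add_mem_cancel_right (mem_polydisc.1 hy i)

theorem vecMul_mem_polydisc {n : ℕ} {k l : ℤ} {x : Fin n → FInf Fq}
    {y : Matrix (Fin n) (Fin n) (FInf Fq)} (hx : x ∈ polydisc Fq k n)
    (hy : ∀ i j, y i j ∈ piO Fq l) : x ᵥ* y ∈ polydisc Fq (k + l) n :=
  mem_polydisc.2 fun j => sum_mem_piO _ fun i _ => mul_mem_piO (mem_polydisc.1 hx i) (hy i j)

theorem exists_forall_mem_piO {n : ℕ} (y : Matrix (Fin n) (Fin n) (FInf Fq)) :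
    ∃ k : ℕ, ∀ i j, y i j ∈ piO Fq (-k) := by
  choose k hk using fun i j => exists_mem_piO (y i j)
  refine ⟨∑ i, ∑ j, k i j, fun i j => piO_mono ?_ (hk i j)⟩
  have : k i j ≤ ∑ i, ∑ j, k i j :=
    (Finset.single_le_sum (f := fun j => k i j) (fun _ _ => Nat.zero_le _)
      (Finset.mem_univ j)).trans
    (Finset.single_le_sum (f := fun i => ∑ j, k i j) (fun _ _ => Nat.zero_le _)
      (Finset.mem_univ i))
  omega

theorem mem_lattice_of_polyEmb {n : ℕ} (a : Fin n → Fq[X]) :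
    (fun i => polyEmb Fq (a i)) ∈ lattice Fq n := ⟨a, fun _ => rfl⟩

theorem exists_lattice_add_mem_polydisc {n : ℕ} (x : Fin n → FInf Fq) :
    ∃ β ∈ lattice Fq n, x + β ∈ polydisc Fq 1 n := by
  choose q hq using fun i => exists_polyEmb_add_mem (x i)
  refine ⟨_, mem_lattice_of_polyEmb q, mem_polydisc.2 fun i => ?_⟩
  rw [Pi.add_apply, add_comm]
  exact hq i

theorem polyDot_add {n : ℕ} (a : Fin n → Fq[X]) (x y : Fin n → FInf Fq) :
    polyDot a (x + y) = polyDot a x + polyDot a y := by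
  simp [polyDot, mul_add, Finset.sum_add_distrib]

theorem polyDot_neg {n : ℕ} (a : Fin n → Fq[X]) (x : Fin n → FInf Fq) :
    polyDot a (-x) = -polyDot a x := by
  simp [polyDot]

theorem polyDot_single {n : ℕ} (a : Fin n → Fq[X]) (i : Fin n) (c : FInf Fq) :
    polyDot a (Pi.single i c) = polyEmb Fq (a i) * c := by
  rw [polyDot, Finset.sum_eq_single i]
  · simp
  · intro j _ hj
    simp [hj]
  · simp

theorem polyDot_lattice {n : ℕ} (a : Fin n → Fq[X]) {β : Fin n → FInf Fq}
    (hβ : β ∈ lattice Fq n) : ∃ b, polyDot a β = polyEmb Fq b := by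
  obtain ⟨b, hb⟩ := hβ
  exact ⟨∑ i, a i * b i, by simp [polyDot, hb]⟩

theorem psi_polyDot_lattice {p : ℕ} [Algebra (ZMod p) Fq] (ψ₀ : AddChar (ZMod p) ℂ) {n : ℕ}
    (a : Fin n → Fq[X]) {β : Fin n → FInf Fq} (hβ : β ∈ lattice Fq n) :
    psi ψ₀ (polyDot a β) = 1 := by
  obtain ⟨b, hb⟩ := polyDot_lattice a hβ
  rw [hb, psi_polyEmb]

section

variable {n : ℕ}

theorem measurableSet_polydisc (k : ℤ) : MeasurableSet (polydisc Fq k n) :=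
  (isOpen_polydisc Fq k n).measurableSet

theorem continuous_of_polydisc_invariant {k : ℤ} {f : (Fin n → FInf Fq) → ℂ}
    (hf : ∀ x, ∀ w ∈ polydisc Fq k n, f (x + w) = f x) : Continuous f := by
  refine ((IsLocallyConstant.iff_exists_open f).2 fun x =>
    ⟨(fun y => y - x) ⁻¹' polydisc Fq k n,
      (isOpen_polydisc Fq k n).preimage (continuous_id.sub continuous_const), ?_, ?_⟩).continuous
  · rw [Set.mem_preimage, sub_self]
    exact mem_polydisc.2 fun i => (piO Fq k).zero_mem
  · intro y hy
    have := hf x _ hy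
    rwa [add_sub_cancel] at this

theorem polyEmb_mem_piO_of_degree_lt {m : ℕ} {q : Fq[X]} (hq : q.degree < m) :
    polyEmb Fq q ∈ piO Fq (1 - m) := fun j hj => by
  rw [coeff_polyEmb]
  split_ifs
  · exact coeff_eq_zero_of_degree_lt (hq.trans_le (by exact_mod_cast (by omega)))
  · rfl

theorem exists_forall_degree_lt (a : Fin n → Fq[X]) : ∃ m : ℕ, ∀ i, (a i).degree < m := by
  refine ⟨∑ i, (a i).natDegree + 1, fun i => degree_le_natDegree.trans_lt ?_⟩
  have := Finset.single_le_sum (f := fun i => (a i).natDegree) (fun _ _ => Nat.zero_le _)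
    (Finset.mem_univ i)
  exact_mod_cast Nat.lt_succ_of_le this

theorem add_polyDot {a b : Fin n → Fq[X]} (x : Fin n → FInf Fq) :
    polyDot (a + b) x = polyDot a x + polyDot b x := by
  simp [polyDot, add_mul, Finset.sum_add_distrib]

theorem polyDot_mem_piO {m : ℕ} {a : Fin n → Fq[X]} (ha : ∀ i, (a i).degree < m)
    {k : ℤ} {w : Fin n → FInf Fq} (hw : w ∈ polydisc Fq k n) :
    polyDot a w ∈ piO Fq (1 - m + k) :=
  sum_mem_piO _ fun i _ => mul_mem_piO (polyEmb_mem_piO_of_degree_lt (ha i)) (mem_polydisc.1 hw i)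

end

end Integers

/-! ### Fourier analysis on `A^n \ F_∞^n`. -/

section Fourier

variable {p : ℕ} {Fq : Type*} [Field Fq] [Fintype Fq] [Algebra (ZMod p) Fq]
  (ψ₀ : AddChar (ZMod p) ℂ) {n : ℕ}

/-- `f` is invariant under translation by `A^n` and by `(π^k O_∞)^n`. -/
def IsPeriodic (k : ℤ) (f : (Fin n → FInf Fq) → ℂ) : Prop :=
  (∀ x, ∀ β ∈ lattice Fq n, f (x + β) = f x) ∧ ∀ x, ∀ w ∈ polydisc Fq k n, f (x + w) = f x

/-- The Fourier coefficient at `a ∈ A^n` of an `A^n`-invariant function on `F_∞^n`. -/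
def latticeFourier (f : (Fin n → FInf Fq) → ℂ) (a : Fin n → Fq[X]) : ℂ :=
  ∫ u in polydisc Fq 1 n, f u * psi ψ₀ (-polyDot a u) ∂(haarF Fq n)

instance instIsAddHaarMeasureHaarF : (haarF Fq n).IsAddHaarMeasure :=
  inferInstanceAs (Measure.addHaarMeasure (polydiscCompacts Fq n)).IsAddHaarMeasure

theorem haarF_polydisc_one : haarF Fq n (polydisc Fq 1 n) = 1 :=
  Measure.addHaarMeasure_self (K₀ := polydiscCompacts Fq n)

theorem isCompact_polydisc (k : ℤ) : IsCompact (polydisc Fq k n) :=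
  isCompact_univ_pi fun _ => isCompact_piO k

theorem IsPeriodic.integrableOn {k : ℤ} {f : (Fin n → FInf Fq) → ℂ} (hf : IsPeriodic k f)
    (a : Fin n → Fq[X]) :
    IntegrableOn (fun u => f u * psi ψ₀ (-polyDot a u)) (polydisc Fq 1 n) (haarF Fq n) := by
  obtain ⟨m, hm⟩ := exists_forall_degree_lt a
  refine ContinuousOn.integrableOn_compact (isCompact_polydisc 1) (Continuous.continuousOn ?_)
  -- Entries of degree `< m` lie in `π^{1-m} O_∞`, so pairing with `w ∈ (π^{m+1} O_∞)^n` lands in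
  -- `π² O_∞`, where `ψ` is trivial.
  refine continuous_of_polydisc_invariant (k := max k (m + 1)) fun x w hw => ?_
  have hle : ∀ l ≤ max k ((m : ℤ) + 1), w ∈ polydisc Fq l n := fun l hl =>
    mem_polydisc.2 fun i => piO_mono hl (mem_polydisc.1 hw i)
  rw [hf.2 x w (hle _ (le_max_left _ _)), polyDot_add, neg_add, psi_add,
    psi_eq_one_of_mem_piO ψ₀ (x := -polyDot a w), mul_one]
  have := polyDot_mem_piO hm (hle _ (le_max_right _ _))
  exact piO_mono (by omega) ((piO Fq _).neg_mem this)

/-- The integral of an `A^n`-invariant function over the fundamental domain `(π O_∞)^n` is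
translation invariant. -/
theorem setIntegral_polydisc_add {f : (Fin n → FInf Fq) → ℂ}
    (hf : ∀ x, ∀ β ∈ lattice Fq n, f (x + β) = f x) (t : Fin n → FInf Fq) :
    ∫ u in polydisc Fq 1 n, f (u + t) ∂(haarF Fq n) =
      ∫ u in polydisc Fq 1 n, f u ∂(haarF Fq n) := by
  obtain ⟨β, hβ, ht⟩ := exists_lattice_add_mem_polydisc t
  rw [← integral_indicator (measurableSet_polydisc 1),
    ← integral_indicator (measurableSet_polydisc 1),
    -- Translation by `t + β` preserves the polydisc because `t + β` lies in it; periodicity then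
    -- removes `β`.
    ← integral_add_right_eq_self ((polydisc Fq 1 n).indicator f) (t + β)]
  refine integral_congr_ae (Filter.Eventually.of_forall fun u => ?_)
  beta_reduce
  by_cases hu : u ∈ polydisc Fq 1 n
  · rw [Set.indicator_of_mem hu, Set.indicator_of_mem ((add_mem_polydisc_iff ht).2 hu),
      ← add_assoc, hf _ β hβ]
  · rw [Set.indicator_of_notMem hu, Set.indicator_of_notMem (mt (add_mem_polydisc_iff ht).1 hu)]

/-- Since `ψ` is trivial on `A`, the whole integrand is `A^n`-periodic and can be translated. -/
theorem latticeFourier_add_right {f : (Fin n → FInf Fq) → ℂ}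
    (hf : ∀ x, ∀ β ∈ lattice Fq n, f (x + β) = f x) (t : Fin n → FInf Fq) (a : Fin n → Fq[X]) :
    latticeFourier ψ₀ (fun x => f (x + t)) a = psi ψ₀ (polyDot a t) * latticeFourier ψ₀ f a := by
  have h := setIntegral_polydisc_add (f := fun u => f u * psi ψ₀ (-polyDot a u)) (fun x β hβ => by
    simp only [hf x β hβ, polyDot_add, neg_add, psi_add, psi_neg _ (polyDot a β),
      psi_polyDot_lattice ψ₀ a hβ, inv_one, mul_one]) t
  rw [latticeFourier, latticeFourier, ← h, ← integral_const_mul]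
  refine integral_congr_ae (Filter.Eventually.of_forall fun u => ?_)
  simp only [polyDot_add, neg_add, psi_add, psi_neg _ (polyDot a t)]
  field_simp [psi_ne_zero ψ₀ (polyDot a t)]

/-- Invariance under `t` makes the coefficient equal to `ψ(a·t)` times itself. -/
theorem latticeFourier_eq_zero {f : (Fin n → FInf Fq) → ℂ}
    (hf : ∀ x, ∀ β ∈ lattice Fq n, f (x + β) = f x) {t : Fin n → FInf Fq}
    (ht : ∀ x, f (x + t) = f x) {a : Fin n → Fq[X]} (ha : psi ψ₀ (polyDot a t) ≠ 1) :
    latticeFourier ψ₀ f a = 0 := by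
  have := latticeFourier_add_right ψ₀ hf t a
  simp only [ht] at this
  have h : (psi ψ₀ (polyDot a t) - 1) * latticeFourier ψ₀ f a = 0 := by
    rw [sub_mul, one_mul, ← this, sub_self]
  exact (mul_eq_zero.1 h).resolve_left (sub_ne_zero.2 ha)

theorem latticeFourier_sum {ι : Type*} (s : Finset ι) {k : ℤ} {f : ι → (Fin n → FInf Fq) → ℂ}
    (hf : ∀ i ∈ s, IsPeriodic k (f i)) (a : Fin n → Fq[X]) :
    latticeFourier ψ₀ (fun x => ∑ i ∈ s, f i x) a = ∑ i ∈ s, latticeFourier ψ₀ (f i) a := by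
  simp only [latticeFourier, Finset.sum_mul]
  exact integral_finsetSum _ fun i hi => (hf i hi).integrableOn ψ₀ a

variable {ψ₀}

theorem exists_psi_polyDot_ne_one [Fact p.Prime] (hψ₀ : ψ₀ ≠ 1) {a : Fin n → Fq[X]} (ha : a ≠ 0) :
    ∃ t, psi ψ₀ (polyDot a t) ≠ 1 := by
  obtain ⟨i, hi⟩ := Function.ne_iff.1 ha
  obtain ⟨c, hc⟩ := exists_psi_single_mul_ne_one hψ₀ (f := polyEmb Fq (a i))
    (n := -((a i).natDegree : ℤ)) (by
      rw [coeff_polyEmb, if_pos (by omega)]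
      simpa using hi)
  exact ⟨Pi.single i (HahnSeries.single _ c), by rwa [polyDot_single, mul_comm]⟩

theorem latticeFourier_one [Fact p.Prime] (hψ₀ : ψ₀ ≠ 1) (a : Fin n → Fq[X]) [Decidable (a = 0)] :
    latticeFourier ψ₀ (fun _ => 1) a = if a = 0 then 1 else 0 := by
  split_ifs with ha
  · subst ha
    simp [latticeFourier, polyDot, psi_zero, haarF_polydisc_one, Measure.real]
  · obtain ⟨t, ht⟩ := exists_psi_polyDot_ne_one hψ₀ ha
    exact latticeFourier_eq_zero ψ₀ (fun _ _ _ => rfl) (t := t) (fun _ => rfl) ht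

variable (Fq n) in
/-- The vectors of polynomials of degree less than `m`. -/
def polyBox (m : ℕ) : AddSubgroup (Fin n → Fq[X]) where
  carrier := {a | ∀ i, (a i).degree < m}
  zero_mem' := fun i => by simp
  add_mem' := fun {a b} ha hb i => (degree_add_le _ _).trans_lt (max_lt (ha i) (hb i))
  neg_mem' := fun {a} ha i => by
    rw [Pi.neg_apply, degree_neg]
    exact ha i

instance instFinitePolyBox (m : ℕ) : Finite (polyBox Fq n m) := by
  refine Finite.of_injective (β := Fin n → Fin m → Fq) (fun a i j => (a.1 i).coeff j) ?_
  intro a b hab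
  refine Subtype.ext (funext fun i => Polynomial.ext fun j => ?_)
  by_cases hj : j < m
  · exact congr_fun (congr_fun hab i) ⟨j, hj⟩
  · rw [coeff_eq_zero_of_degree_lt ((a.2 i).trans_le (by exact_mod_cast (by omega))),
      coeff_eq_zero_of_degree_lt ((b.2 i).trans_le (by exact_mod_cast (by omega)))]

instance instFintypePolyBox (m : ℕ) : Fintype (polyBox Fq n m) := Fintype.ofFinite _

/-- The annihilator of the polynomials of degree `< m` under `ψ` is `A^n + (π^{m+1} O_∞)^n`. -/
theorem exists_lattice_add_mem_of_psi_eq_one [Fact p.Prime] (hψ₀ : ψ₀ ≠ 1) {m : ℕ}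
    {t : Fin n → FInf Fq} (ht : ∀ a ∈ polyBox Fq n m, psi ψ₀ (polyDot a t) = 1) :
    ∃ β ∈ lattice Fq n, t + β ∈ polydisc Fq (m + 1) n := by
  obtain ⟨β, hβ, htβ⟩ := exists_lattice_add_mem_polydisc t
  refine ⟨β, hβ, mem_polydisc.2 fun i j hj => ?_⟩
  by_cases hj1 : j < 1
  · exact mem_polydisc.1 htβ i j hj1
  by_contra hne
  obtain ⟨c, hc⟩ := exists_psi_single_mul_ne_one hψ₀ hne
  -- A multiple of `T^{j-1}` tests the coefficient of `π^j`; here `1 ≤ j ≤ m`, so its degree is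
  -- below `m`.
  have hmem : (Pi.single i (monomial (j - 1).toNat c) : Fin n → Fq[X]) ∈ polyBox Fq n m := by
    intro i'
    by_cases h : i' = i
    · subst h
      rw [Pi.single_eq_same]
      exact (degree_monomial_le _ _).trans_lt (by exact_mod_cast (by omega))
    · rw [Pi.single_eq_of_ne h, degree_zero]
      exact WithBot.bot_lt_coe _
  have h1 : psi ψ₀ (polyDot (Pi.single i (monomial (j - 1).toNat c)) (t + β)) = 1 := by
    rw [polyDot_add, psi_add, ht _ hmem, psi_polyDot_lattice ψ₀ _ hβ, one_mul]
  refine hc ?_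
  rw [← h1, polyDot, Finset.sum_eq_single i]
  · rw [Pi.single_eq_same]
    congr 2
    ext l
    rw [coeff_polyEmb, HahnSeries.coeff_single, coeff_monomial]
    split_ifs <;> first | rfl | omega
  · intro i' _ h
    simp [h]
  · simp

/-- Fourier inversion for functions invariant under `A^n` and `(π^{m+1} O_∞)^n`. -/
theorem IsPeriodic.fourier_inversion [Fact p.Prime] (hψ₀ : ψ₀ ≠ 1) {m : ℕ}
    {f : (Fin n → FInf Fq) → ℂ} (hf : IsPeriodic ((m : ℤ) + 1) f) (x : Fin n → FInf Fq) :
    f x = ∑ a : polyBox Fq n m, latticeFourier ψ₀ f a * psi ψ₀ (polyDot a.1 x) := by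
  classical
  have key : ∀ g : (Fin n → FInf Fq) → ℂ, IsPeriodic ((m : ℤ) + 1) g →
      ∑ a : polyBox Fq n m, latticeFourier ψ₀ g a * psi ψ₀ (polyDot a.1 x) =
        ∫ u in polydisc Fq 1 n, g u * ∑ a : polyBox Fq n m, psi ψ₀ (polyDot a.1 (x - u))
          ∂(haarF Fq n) := by
    intro g hg
    simp only [latticeFourier, ← integral_mul_const]
    rw [← integral_finsetSum _ fun a _ => (hg.integrableOn ψ₀ a.1).mul_const _]
    refine integral_congr_ae (Filter.Eventually.of_forall fun u => ?_)
    simp only [Finset.mul_sum]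
    refine Finset.sum_congr rfl fun a _ => ?_
    rw [sub_eq_add_neg, polyDot_add, polyDot_neg, psi_add]
    ring
  -- The kernel is a character sum over a finite group. Where it is nonzero, `x - u` is a period of
  -- `f`, so `f u = f x`.
  have kernel : ∀ u, f u * ∑ a : polyBox Fq n m, psi ψ₀ (polyDot a.1 (x - u)) =
      f x * (1 * ∑ a : polyBox Fq n m, psi ψ₀ (polyDot a.1 (x - u))) := by
    intro u
    let χ : AddChar (polyBox Fq n m) ℂ :=
      { toFun := fun a => psi ψ₀ (polyDot a.1 (x - u))
        map_zero_eq_one' := by simp [polyDot, psi_zero]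
        map_add_eq_mul' := fun a b => by
          rw [AddSubgroup.coe_add, add_polyDot, psi_add] }
    have hsum : ∑ a : polyBox Fq n m, psi ψ₀ (polyDot a.1 (x - u)) = ∑ a, χ a := rfl
    rw [hsum, AddChar.sum_eq_ite, one_mul]
    split_ifs with hχ
    · obtain ⟨β, hβ, hw⟩ := exists_lattice_add_mem_of_psi_eq_one hψ₀ (t := x - u) (m := m)
        fun a ha => by
          have := DFunLike.congr_fun hχ ⟨a, ha⟩
          exact this
      have h1 := hf.2 u _ hw
      rw [← add_assoc, add_sub_cancel, hf.1 _ _ hβ] at h1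
      rw [h1]
    · simp
  have hone : IsPeriodic ((m : ℤ) + 1) (fun _ : Fin n → FInf Fq => (1 : ℂ)) :=
    ⟨fun _ _ _ => rfl, fun _ _ _ => rfl⟩
  rw [key f hf]
  simp only [kernel]
  -- Reading the remaining integral as the expansion of the constant function `1` avoids computing
  -- the volume of a small polydisc.
  rw [integral_const_mul, ← key _ hone]
  simp only [latticeFourier_one hψ₀]
  rw [Finset.sum_eq_single 0]
  · simp [polyDot, psi_zero]
  · intro a _ ha
    rw [if_neg (fun h : a.1 = 0 => ha (Subtype.ext h)), zero_mul]
  · simp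

theorem IsPeriodic.ext [Fact p.Prime] (hψ₀ : ψ₀ ≠ 1) {m : ℕ} {f g : (Fin n → FInf Fq) → ℂ}
    (hf : IsPeriodic ((m : ℤ) + 1) f) (hg : IsPeriodic ((m : ℤ) + 1) g)
    (h : ∀ a, latticeFourier ψ₀ f a = latticeFourier ψ₀ g a) : f = g := by
  funext x
  rw [hf.fourier_inversion hψ₀, hg.fourier_inversion hψ₀]
  simp only [h]

end Fourier

/-! ### Generators of `GL_n(F_∞)`. -/

section Generation

variable {Fq : Type*} [Field Fq] {n : ℕ}

/-- The image of `GL_n(O_∞)` in `GL_n(F_∞)`. -/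
def integralGL (κ : GL (Fin n) (PowerSeries Fq)) : GL (Fin n) (FInf Fq) :=
  Matrix.GeneralLinearGroup.map (intEmb Fq) κ

theorem diagGL_mul (v w : Fin n → (FInf Fq)ˣ) : diagGL (v * w) = diagGL v * diagGL w :=
  Units.ext (by simp [diagGL, Matrix.diagonal_mul_diagonal])

theorem diagGL_one : diagGL (1 : Fin n → (FInf Fq)ˣ) = 1 :=
  Units.ext (by simp [diagGL])

variable (Fq n) in
/-- `diagGL` as a homomorphism. -/
def diagHom : (Fin n → (FInf Fq)ˣ) →* GL (Fin n) (FInf Fq) where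
  toFun := diagGL
  map_one' := diagGL_one
  map_mul' := diagGL_mul

theorem tUnit_zpow_val (k : ℤ) :
    ((tUnit Fq ^ k : (FInf Fq)ˣ) : FInf Fq) = HahnSeries.single (-k) 1 := by
  induction k using Int.induction_on with
  | zero => rfl
  | succ i ih =>
    rw [zpow_add_one, Units.val_mul, ih, tUnit_val, HahnSeries.single_mul_single, one_mul]
    exact congrArg (fun j : ℤ => HahnSeries.single j (1 : Fq)) (by ring)
  | pred i ih =>
    rw [zpow_sub_one, Units.val_mul, ih, tUnit_inv_val, HahnSeries.single_mul_single, one_mul]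
    exact congrArg (fun j : ℤ => HahnSeries.single j (1 : Fq)) (by ring)

theorem exists_eq_tUnit_zpow_mul (x : (FInf Fq)ˣ) :
    ∃ (k : ℤ) (u : (PowerSeries Fq)ˣ), x = tUnit Fq ^ k * Units.map (intEmb Fq) u := by
  have hu : IsUnit (LaurentSeries.powerSeriesPart (x : FInf Fq)) := by
    rw [PowerSeries.isUnit_iff_constantCoeff, ← PowerSeries.coeff_zero_eq_constantCoeff_apply,
      LaurentSeries.powerSeriesPart_coeff]
    simp [HahnSeries.coeff_order_eq_zero.not.2 x.ne_zero]
  obtain ⟨u, hu⟩ := hu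
  refine ⟨-(x : FInf Fq).order, u, Units.ext ?_⟩
  have h := LaurentSeries.single_order_mul_powerSeriesPart (x : FInf Fq)
  rw [← hu] at h
  rw [Units.val_mul, Units.coe_map, tUnit_zpow_val, neg_neg]
  exact h.symm

theorem integralGL_apply (κ : GL (Fin n) (PowerSeries Fq)) (i j : Fin n) :
    (integralGL κ).val i j = intEmb Fq (κ.val i j) := rfl

theorem exists_integralGL_eq_diagGL (u : Fin n → (PowerSeries Fq)ˣ) :
    ∃ κ, integralGL κ = diagGL fun i => Units.map (intEmb Fq).toMonoidHom (u i) := by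
  refine ⟨⟨Matrix.diagonal fun i => (u i : PowerSeries Fq),
    Matrix.diagonal fun i => ((u i)⁻¹ : (PowerSeries Fq)ˣ), by simp [Matrix.diagonal_mul_diagonal],
    by simp [Matrix.diagonal_mul_diagonal]⟩, Units.ext ?_⟩
  ext i j : 2
  rw [integralGL_apply]
  simp only [diagGL, Matrix.diagonal_apply]
  split_ifs <;> simp

theorem exists_integralGL_eq_transvection {i j : Fin n} (hij : i ≠ j) (z : PowerSeries Fq) :
    ∃ κ, (integralGL κ).val = Matrix.transvection i j (intEmb Fq z) := by
  refine ⟨⟨Matrix.transvection i j z, Matrix.transvection i j (-z), ?_, ?_⟩, ?_⟩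
  · rw [Matrix.transvection_mul_transvection_same _ _ hij]
    simp
  · rw [Matrix.transvection_mul_transvection_same _ _ hij]
    simp
  · ext a b : 1
    rw [integralGL_apply]
    simp only [Matrix.transvection, Matrix.add_apply, Matrix.one_apply, Matrix.single_apply]
    split_ifs <;> simp

/-- A subgroup of `GL_n(F_∞)` that contains `GL_n(O_∞)` and the matrices `diag(1, …, T, …, 1)`
is everything. -/
theorem subgroup_eq_top (G : Subgroup (GL (Fin n) (FInf Fq))) (hint : ∀ κ, integralGL κ ∈ G)
    (hT : ∀ i, diagGL (Pi.mulSingle i (tUnit Fq)) ∈ G) (y : GL (Fin n) (FInf Fq)) : y ∈ G := by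
  have hTk : ∀ e : Fin n → ℤ, diagGL (fun i => tUnit Fq ^ e i) ∈ G := by
    intro e
    have : (fun i => tUnit Fq ^ e i) ∈ G.comap (diagHom Fq n) := by
      rw [← Finset.univ_prod_mulSingle fun i => tUnit Fq ^ e i]
      refine Subgroup.prod_mem _ fun i _ => ?_
      rw [Pi.mulSingle_zpow]
      exact Subgroup.zpow_mem (G.comap (diagHom Fq n)) (x := Pi.mulSingle i (tUnit Fq)) (hT i) _
    exact this
  have hdiag : ∀ v : Fin n → (FInf Fq)ˣ, diagGL v ∈ G := by
    intro v
    choose e u h using fun i => exists_eq_tUnit_zpow_mul (v i)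
    obtain ⟨κ, hκ⟩ := exists_integralGL_eq_diagGL u
    have : v = (fun i => tUnit Fq ^ e i) * fun i => Units.map (intEmb Fq).toMonoidHom (u i) :=
      funext h
    rw [this, diagGL_mul, ← hκ]
    exact G.mul_mem (hTk e) (hint κ)
  -- With `π^k c` integral, conjugating the integral transvection by `T^k` in place `i` multiplies
  -- its entry by `T^k` and gives back `c`.
  have htrans : ∀ (i j : Fin n), i ≠ j → ∀ c : FInf Fq,
      ∃ g ∈ G, g.val = Matrix.transvection i j c := by
    intro i j hij c
    obtain ⟨k, hk⟩ := exists_mem_piO c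
    obtain ⟨z, hz⟩ : ∃ z, intEmb Fq z = HahnSeries.single (k : ℤ) 1 * c :=
      mem_piO_zero_iff.1 (by simpa using mul_mem_piO (single_mem_piO (k : ℤ) (1 : Fq)) hk)
    obtain ⟨κ, hκ⟩ := exists_integralGL_eq_transvection hij z
    let t : (FInf Fq)ˣ := tUnit Fq ^ k
    refine ⟨diagGL (Pi.mulSingle i t) * integralGL κ * diagGL (Pi.mulSingle i t⁻¹),
      G.mul_mem (G.mul_mem (hdiag _) (hint κ)) (hdiag _), ?_⟩
    have ht : (t : FInf Fq) * HahnSeries.single (k : ℤ) 1 = 1 := by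
      simp [t, tUnit_val, HahnSeries.single_pow, HahnSeries.single_mul_single]
    rw [Units.val_mul, Units.val_mul, hκ, hz]
    ext a b : 1
    simp only [diagGL, Matrix.mul_diagonal, Matrix.diagonal_mul, Matrix.transvection,
      Matrix.add_apply, Matrix.one_apply, Matrix.single_apply]
    by_cases ha : a = i
    · subst ha
      by_cases hb : a = b
      · subst hb
        simp [hij.symm]
      · have hb' : b ≠ a := fun h => hb h.symm
        by_cases hj : j = b
        · subst hj
          simp [hb, hb', ← mul_assoc, ht]
        · simp [hb, hj]
    · by_cases hb : a = b
      · subst hb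
        simp [ha, Ne.symm ha]
      · simp [hb, Ne.symm ha]
  obtain ⟨g, hg, h⟩ : ∃ g ∈ G, g.val = y.val := by
    refine Matrix.diagonal_transvection_induction_of_det_ne_zero
      (fun M => ∃ g ∈ G, g.val = M) y.val ?_ ?_ ?_ ?_
    · exact ((Matrix.isUnit_iff_isUnit_det _).1 y.isUnit).ne_zero
    · intro D hD
      rw [Matrix.det_diagonal, Finset.prod_ne_zero_iff] at hD
      exact ⟨_, hdiag fun i => Units.mk0 (D i) (hD i (Finset.mem_univ i)), rfl⟩
    · rintro ⟨i, j, hij, c⟩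
      exact htrans i j hij c
    · rintro A B - - ⟨g, hg, rfl⟩ ⟨g', hg', rfl⟩
      exact ⟨g * g', G.mul_mem hg hg', rfl⟩
  rwa [← Units.ext h]

end Generation

/-! ### Absolute values of determinants. -/

section AbsoluteValue

variable {Fq : Type*} [Field Fq] [Fintype Fq]

theorem card_ne_zero_real : (Fintype.card Fq : ℝ) ≠ 0 := by
  exact_mod_cast Fintype.card_ne_zero

theorem absInf_mul (x y : FInf Fq) : absInf (x * y) = absInf x * absInf y := by
  unfold absInf
  by_cases hx : x = 0
  · simp [hx]
  by_cases hy : y = 0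
  · simp [hy]
  rw [if_neg hx, if_neg hy, if_neg (mul_ne_zero hx hy), HahnSeries.order_mul hx hy, neg_add,
    zpow_add₀ card_ne_zero_real]

theorem absInf_ne_zero {x : FInf Fq} (hx : x ≠ 0) : absInf x ≠ 0 := by
  rw [absInf, if_neg hx]
  exact zpow_ne_zero _ card_ne_zero_real

theorem absInf_one : absInf (1 : FInf Fq) = 1 := by
  simp [absInf]

theorem absInf_tUnit : absInf (tUnit Fq : FInf Fq) = Fintype.card Fq := by
  rw [absInf, if_neg (tUnit Fq).ne_zero, tUnit_val, HahnSeries.order_single one_ne_zero]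
  simp

theorem absInf_prod {ι : Type*} (s : Finset ι) (f : ι → FInf Fq) :
    absInf (∏ i ∈ s, f i) = ∏ i ∈ s, absInf (f i) :=
  map_prod (⟨⟨absInf, absInf_one⟩, absInf_mul⟩ : FInf Fq →* ℝ) f s

/-- The orders of `u` and `u⁻¹` are nonnegative and add up to zero. -/
theorem absInf_intEmb_unit (u : (PowerSeries Fq)ˣ) : absInf (intEmb Fq u) = 1 := by
  have hne : ∀ v : (PowerSeries Fq)ˣ, intEmb Fq (v : PowerSeries Fq) ≠ 0 := fun v =>
    (v.isUnit.map (intEmb Fq)).ne_zero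
  have h : ∀ v : (PowerSeries Fq)ˣ, 0 ≤ (intEmb Fq (v : PowerSeries Fq)).order := fun v =>
    (HahnSeries.le_order_iff_forall (hne v)).2 (mem_piO_zero_iff.2 ⟨v, rfl⟩)
  have h1 : (intEmb Fq (u : PowerSeries Fq)).order +
      (intEmb Fq ((u⁻¹ : (PowerSeries Fq)ˣ) : PowerSeries Fq)).order = 0 := by
    rw [← HahnSeries.order_mul (hne u) (hne _), ← map_mul, Units.mul_inv, map_one,
      HahnSeries.order_one]
  have h2 : (intEmb Fq (u : PowerSeries Fq)).order = 0 := by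
    have := h u
    have := h u⁻¹
    omega
  rw [absInf, if_neg (hne u), h2, neg_zero, zpow_zero]

theorem absInf_det_ne_zero {n : ℕ} (y : GL (Fin n) (FInf Fq)) : absInf y.val.det ≠ 0 :=
  absInf_ne_zero ((Matrix.isUnit_iff_isUnit_det _).1 y.isUnit).ne_zero

theorem absInf_det_mul {n : ℕ} (y z : GL (Fin n) (FInf Fq)) :
    absInf (y * z).val.det = absInf y.val.det * absInf z.val.det := by
  rw [Units.val_mul, Matrix.det_mul, absInf_mul]

theorem absInf_det_integralGL {n : ℕ} (κ : GL (Fin n) (PowerSeries Fq)) :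
    absInf (integralGL κ).val.det = 1 := by
  have : (integralGL κ).val.det = intEmb Fq (Matrix.GeneralLinearGroup.det κ : (PowerSeries Fq)ˣ) :=
    ((intEmb Fq).map_det κ.val).symm
  rw [this, absInf_intEmb_unit]

theorem absInf_det_diagGL {n : ℕ} (v : Fin n → (FInf Fq)ˣ) :
    absInf (diagGL v).val.det = ∏ i, absInf (v i : FInf Fq) := by
  rw [← absInf_prod]
  exact congrArg absInf Matrix.det_diagonal

end AbsoluteValue

/-! ### Invariance of `h` and harmonicity in the coordinates `(x, y)`. -/

section Invariance

variable {Fq : Type*} [Field Fq] {r : ℕ}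

theorem map_blockGL {R S : Type*} [CommRing R] [CommRing S] (φ : R →+* S) {n : ℕ} (ε : Rˣ)
    (b : Fin n → R) (d : GL (Fin n) R) :
    Matrix.GeneralLinearGroup.map φ (blockGL ε b d) =
      blockGL (Units.map φ ε) (fun i => φ (b i)) (Matrix.GeneralLinearGroup.map φ d) := by
  refine Units.ext ?_
  have : (0 : Matrix (Fin n) (Fin 1) R).map φ = 0 := by
    ext i j
    simp
  change (Matrix.fromBlocks _ _ _ _).map φ = Matrix.fromBlocks _ _ _ _
  rw [Matrix.fromBlocks_map, this]
  rfl

theorem pMat_mul (b b' : Fin (r - 1) → FInf Fq) (d d' : GL (Fin (r - 1)) (FInf Fq)) :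
    pMat b d * pMat b' d' = pMat (b' + b ᵥ* d'.val) (d * d') := by
  refine Subtype.ext ?_
  change blockGL 1 b d * blockGL 1 b' d' = blockGL 1 _ _
  rw [blockGL_mul]
  simp

theorem exists_eq_pMat (g : PInf Fq r) : ∃ b d, g = pMat b d := by
  obtain ⟨g, b, d, rfl⟩ := g
  exact ⟨b, d, rfl⟩

theorem vecMul_inv_vecMul {n : ℕ} (w : Fin n → FInf Fq) (y : GL (Fin n) (FInf Fq)) :
    (w ᵥ* (y⁻¹).val) ᵥ* y.val = w := by
  rw [Matrix.vecMul_vecMul, ← Units.val_mul, inv_mul_cancel, Units.val_one, Matrix.vecMul_one]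

theorem vecMul_vecMul_inv {n : ℕ} (w : Fin n → FInf Fq) (y : GL (Fin n) (FInf Fq)) :
    (w ᵥ* y.val) ᵥ* (y⁻¹).val = w := by
  rw [Matrix.vecMul_vecMul, ← Units.val_mul, mul_inv_cancel, Units.val_one, Matrix.vecMul_one]

theorem one_mem_gammaInf : (1 : GL (Fin 1 ⊕ Fin (r - 1)) (FInf Fq)) ∈ gammaInf Fq r :=
  ⟨1, 0, 1, by rw [blockGL_one, map_one]⟩

theorem one_mem_PInt : (1 : GL (Fin 1 ⊕ Fin (r - 1)) (FInf Fq)) ∈ PInt Fq r :=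
  ⟨0, 1, by rw [blockGL_one, map_one]⟩

variable {h : PInf Fq r → ℂ}

theorem IsDoubleCosetFunction.valueAt_mul_integralGL (hh : IsDoubleCosetFunction h)
    (x : Fin (r - 1) → FInf Fq) (y : GL (Fin (r - 1)) (FInf Fq))
    (κ : GL (Fin (r - 1)) (PowerSeries Fq)) :
    valueAt h x (y * integralGL κ) = valueAt h x y := by
  refine hh _ _ 1 one_mem_gammaInf _ ⟨0, κ, rfl⟩ ?_
  rw [one_mul, map_blockGL]
  change blockGL 1 _ _ = blockGL 1 _ _ * blockGL _ _ (integralGL κ)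
  rw [blockGL_mul, Units.val_mul, ← Matrix.vecMul_vecMul]
  congr 1
  · simp
  · funext i
    simp

/-- The upper right block is `x y`, so right multiplication by the integral unipotent of row `w`
shifts `x` by `w y⁻¹`. -/
theorem IsDoubleCosetFunction.valueAt_add_vecMul_inv (hh : IsDoubleCosetFunction h)
    (x : Fin (r - 1) → FInf Fq) (y : GL (Fin (r - 1)) (FInf Fq)) {w : Fin (r - 1) → FInf Fq}
    (hw : w ∈ polydisc Fq 0 (r - 1)) :
    valueAt h (x + w ᵥ* (y⁻¹).val) y = valueAt h x y := by
  choose z hz using fun i => mem_piO_zero_iff.1 (mem_polydisc.1 hw i)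
  obtain rfl : (fun i => intEmb Fq (z i)) = w := funext hz
  refine hh _ _ 1 one_mem_gammaInf _ ⟨z, 1, rfl⟩ ?_
  rw [one_mul, map_blockGL, map_one, map_one]
  change blockGL 1 _ _ = blockGL 1 _ _ * blockGL _ _ _
  rw [blockGL_mul, Matrix.add_vecMul, vecMul_inv_vecMul, mul_one, mul_one, Units.val_one,
    Units.val_one, one_smul, Matrix.vecMul_one, add_comm]

theorem IsDoubleCosetFunction.valueAt_add_lattice (hh : IsDoubleCosetFunction h)
    (x : Fin (r - 1) → FInf Fq) (y : GL (Fin (r - 1)) (FInf Fq)) {β : Fin (r - 1) → FInf Fq}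
    (hβ : β ∈ lattice Fq (r - 1)) :
    valueAt h (x + β) y = valueAt h x y := by
  obtain ⟨b, hb⟩ := hβ
  obtain rfl : β = fun i => polyEmb Fq (b i) := funext hb
  refine hh _ _ _ ⟨1, b, 1, rfl⟩ 1 one_mem_PInt ?_
  rw [mul_one, map_blockGL, map_one, map_one]
  change blockGL 1 _ _ = blockGL _ _ _ * blockGL 1 _ _
  rw [blockGL_mul, Matrix.add_vecMul, mul_one, one_mul, Units.val_one, one_smul]

theorem IsDoubleCosetFunction.exists_isPeriodic [Fintype Fq] (hh : IsDoubleCosetFunction h)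
    (y : GL (Fin (r - 1)) (FInf Fq)) :
    ∃ m : ℕ, ∀ k : ℤ, m ≤ k → IsPeriodic k (fun x => valueAt h x y) := by
  obtain ⟨m, hm⟩ := exists_forall_mem_piO y.val
  refine ⟨m, fun k hk => ⟨fun x β hβ => hh.valueAt_add_lattice x y hβ, fun x w hw => ?_⟩⟩
  have hwy : w ᵥ* y.val ∈ polydisc Fq 0 (r - 1) :=
    mem_polydisc.2 fun i => piO_mono (by omega) (mem_polydisc.1 (vecMul_mem_polydisc hw hm) i)
  have := hh.valueAt_add_vecMul_inv x y hwy
  rwa [vecMul_vecMul_inv] at this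

/-- The diagonal matrix `diag(I_{s-1}, T I_{n-s+1})`. -/
def stepGL (Fq : Type*) [Field Fq] (n s : ℕ) : GL (Fin n) (FInf Fq) :=
  diagGL fun i => if (i : ℕ) < s - 1 then 1 else tUnit Fq

theorem stepGL_one (n : ℕ) : stepGL Fq n 1 = diagGL fun _ => tUnit Fq := by
  simp [stepGL]

/-- Extension by zero of a vector of constants. -/
def extendConst {n s : ℕ} (u : Fin (s - 1) → Fq) (i : Fin n) : FInf Fq :=
  if hi : (i : ℕ) < s - 1 then HahnSeries.C (u ⟨i, hi⟩) else 0

/-- The row added on the right is `T u`, and `(x + u y⁻¹) y T = x y T + T u`; hence the shift of `x`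
is by `u y⁻¹`, without the factor `T`. -/
theorem isHarmonic_iff_valueAt [Fintype Fq] : IsHarmonic h ↔
    ∀ (x : Fin (r - 1) → FInf Fq) (y : GL (Fin (r - 1)) (FInf Fq)) (s : ℕ), 1 ≤ s → s ≤ r →
      ∑ u : Fin (s - 1) → Fq,
        valueAt h (x + extendConst u ᵥ* (y⁻¹).val) (y * stepGL Fq (r - 1) 1) =
      valueAt h x (y * stepGL Fq (r - 1) s) := by
  have key : ∀ (x : Fin (r - 1) → FInf Fq) (y : GL (Fin (r - 1)) (FInf Fq)) (s : ℕ),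
      (∑ u : Fin (s - 1) → Fq,
        valueAt h (x + extendConst u ᵥ* (y⁻¹).val) (y * stepGL Fq (r - 1) 1) =
      valueAt h x (y * stepGL Fq (r - 1) s)) ↔
      ∑ u : Fin (s - 1) → Fq,
      h (pMat (x ᵥ* y.val) y * pMat
        (fun i => if hi : (i : ℕ) < s - 1
          then (tUnit Fq : FInf Fq) * HahnSeries.C (u ⟨i, hi⟩) else 0)
        (diagGL fun _ => tUnit Fq)) =
      h (pMat (x ᵥ* y.val) y *
        pMat 0 (diagGL fun i => if (i : ℕ) < s - 1 then 1 else tUnit Fq)) := by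
    intro x y s
    have h1 : ∀ u : Fin (s - 1) → Fq, valueAt h (x + extendConst u ᵥ* (y⁻¹).val)
        (y * stepGL Fq (r - 1) 1) = h (pMat (x ᵥ* y.val) y * pMat
        (fun i => if hi : (i : ℕ) < s - 1
          then (tUnit Fq : FInf Fq) * HahnSeries.C (u ⟨i, hi⟩) else 0)
        (diagGL fun _ => tUnit Fq)) := by
      intro u
      rw [pMat_mul, valueAt, stepGL_one, Units.val_mul, ← Matrix.vecMul_vecMul, Matrix.add_vecMul,
        vecMul_inv_vecMul, Matrix.add_vecMul, add_comm]
      congr 3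
      funext i
      rw [show (diagGL fun _ => tUnit Fq).val =
          Matrix.diagonal fun _ => (tUnit Fq : FInf Fq) from rfl,
        Matrix.vecMul_diagonal, extendConst]
      split_ifs
      · rw [mul_comm]
      · rw [zero_mul]
    have h2 : valueAt h x (y * stepGL Fq (r - 1) s) = h (pMat (x ᵥ* y.val) y *
        pMat 0 (diagGL fun i => if (i : ℕ) < s - 1 then 1 else tUnit Fq)) := by
      rw [pMat_mul, valueAt, Units.val_mul, ← Matrix.vecMul_vecMul, zero_add]
      rfl
    rw [h2]
    simp only [h1]
  constructor
  · exact fun H x y s hs1 hs2 => (key x y s).2 (H _ s hs1 hs2)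
  · intro H g s hs1 hs2
    obtain ⟨b, d, rfl⟩ := exists_eq_pMat g
    have := (key (b ᵥ* (d⁻¹).val) d s).1 (H _ d s hs1 hs2)
    rwa [vecMul_inv_vecMul] at this

end Invariance

/-! ### Admissible frequencies and the matrices `t_s`. -/

section AdmissibleVectors

variable {Fq : Type*} [Field Fq] {n : ℕ}

/-- The vector `a (yᵗ)⁻¹`. -/
def dualVec (a : Fin n → Fq[X]) (y : GL (Fin n) (FInf Fq)) : Fin n → FInf Fq :=
  (fun i => polyEmb Fq (a i)) ᵥ* ((y⁻¹).val)ᵀ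

theorem admissible_iff {r : ℕ} {a : Fin (r - 1) → Fq[X]} {y : GL (Fin (r - 1)) (FInf Fq)} :
    Admissible a y ↔ ∀ i, dualVec a y i ∈ piO Fq 2 := by
  rw [Admissible, ← Matrix.transpose_nonsing_inv, ← Matrix.coe_units_inv, mem_polydisc]
  rfl

theorem dualVec_mul (a : Fin n → Fq[X]) (y z : GL (Fin n) (FInf Fq)) :
    dualVec a (y * z) = dualVec a y ᵥ* ((z⁻¹).val)ᵀ := by
  rw [dualVec, dualVec, mul_inv_rev, Units.val_mul, Matrix.transpose_mul, Matrix.vecMul_vecMul]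

theorem dualVec_mul_diagGL (a : Fin n → Fq[X]) (y : GL (Fin n) (FInf Fq))
    (v : Fin n → (FInf Fq)ˣ) (i : Fin n) :
    dualVec a (y * diagGL v) i = dualVec a y i * ((v i)⁻¹ : (FInf Fq)ˣ) := by
  rw [dualVec_mul, show ((diagGL v)⁻¹).val = Matrix.diagonal fun i => ((v i)⁻¹ : (FInf Fq)ˣ).val
    from rfl, Matrix.diagonal_transpose, Matrix.vecMul_diagonal]

/-- Adjointness of `y⁻¹` and its transpose. Through it the character `ψ(a·x)` on translations by `w
y⁻¹` is read off from `dualVec a y`. -/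
theorem polyDot_vecMul_inv (a : Fin n → Fq[X]) (y : GL (Fin n) (FInf Fq)) (w : Fin n → FInf Fq) :
    polyDot a (w ᵥ* (y⁻¹).val) = ∑ i, dualVec a y i * w i := by
  change (fun i => polyEmb Fq (a i)) ⬝ᵥ _ = dualVec a y ⬝ᵥ w
  rw [dualVec, Matrix.vecMul_transpose, ← Matrix.mulVec_transpose, Matrix.dotProduct_mulVec,
    Matrix.vecMul_transpose]

theorem mul_tUnit_inv_mem_piO_iff {f : FInf Fq} {k : ℤ} :
    f * ((tUnit Fq)⁻¹ : (FInf Fq)ˣ).val ∈ piO Fq (k + 1) ↔ f ∈ piO Fq k := by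
  refine ⟨fun h => ?_, fun h => mul_mem_piO h tUnit_inv_mem_piO⟩
  have := mul_mem_piO h tUnit_mem_piO
  rwa [mul_assoc, Units.inv_mul, mul_one, add_neg_cancel_right] at this

/-- Multiplying by `t_s` divides the dual coordinates of index at least `s - 1` by `T` and keeps the
others. The first condition is independent of `s`; the second is the one under which the character
sum over `u` survives. -/
theorem admissible_mul_stepGL_iff {r : ℕ} {a : Fin (r - 1) → Fq[X]}
    {y : GL (Fin (r - 1)) (FInf Fq)} {s : ℕ} :
    Admissible a (y * stepGL Fq (r - 1) s) ↔
      (∀ i, dualVec a y i ∈ piO Fq 1) ∧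
        ∀ i : Fin (r - 1), (i : ℕ) < s - 1 → (dualVec a y i).coeff 1 = 0 := by
  have h12 : ∀ f : FInf Fq, f ∈ piO Fq 2 ↔ f ∈ piO Fq 1 ∧ f.coeff 1 = 0 := fun f =>
    ⟨fun h => ⟨piO_mono (by norm_num) h, h 1 (by norm_num)⟩, fun h j hj => by
      rcases (show j < 1 ∨ j = 1 by omega) with h' | rfl
      exacts [h.1 j h', h.2]⟩
  rw [admissible_iff, ← forall_and]
  refine forall_congr' fun i => ?_
  rw [stepGL, dualVec_mul_diagGL]
  split_ifs with hi
  · simp [h12, hi]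
  · rw [show (2 : ℤ) = 1 + 1 from rfl, mul_tUnit_inv_mem_piO_iff]
    simp [hi]

theorem Admissible.mul_stepGL_one {r : ℕ} {a : Fin (r - 1) → Fq[X]}
    {y : GL (Fin (r - 1)) (FInf Fq)} {s : ℕ} (h : Admissible a (y * stepGL Fq (r - 1) s)) :
    Admissible a (y * stepGL Fq (r - 1) 1) :=
  admissible_mul_stepGL_iff.2 ⟨(admissible_mul_stepGL_iff.1 h).1, fun i hi => absurd hi (by simp)⟩

theorem Admissible.mul_stepGL {r : ℕ} {a : Fin (r - 1) → Fq[X]}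
    {y : GL (Fin (r - 1)) (FInf Fq)} (h : Admissible a y) (s : ℕ) :
    Admissible a (y * stepGL Fq (r - 1) s) := by
  rw [admissible_iff] at h
  exact admissible_mul_stepGL_iff.2
    ⟨fun i => piO_mono (by norm_num) (h i), fun i _ => h i 1 (by norm_num)⟩

theorem coeff_mul_C (f : FInf Fq) (c : Fq) (k : ℤ) :
    (f * HahnSeries.C c).coeff k = c * f.coeff k := by
  rw [mul_comm, HahnSeries.C_apply, coeff_single_mul, sub_zero]

theorem extendConst_zero {s : ℕ} : (extendConst (0 : Fin (s - 1) → Fq) : Fin n → FInf Fq) = 0 := by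
  funext i
  rw [extendConst]
  split_ifs <;> simp

theorem extendConst_add {s : ℕ} (u v : Fin (s - 1) → Fq) :
    (extendConst (u + v) : Fin n → FInf Fq) = extendConst u + extendConst v := by
  funext i
  rw [Pi.add_apply, extendConst, extendConst, extendConst]
  split_ifs <;> simp

theorem extendConst_single {s : ℕ} (i : Fin n) (hi : (i : ℕ) < s - 1) (d : Fq) :
    (extendConst (Pi.single (⟨i, hi⟩ : Fin (s - 1)) d) : Fin n → FInf Fq) =
      Pi.single i (HahnSeries.C d) := by
  funext j
  rw [extendConst]
  by_cases hj : j = i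
  · subst hj
    rw [dif_pos hi, Pi.single_eq_same, Pi.single_eq_same]
  · rw [Pi.single_eq_of_ne hj]
    split_ifs
    · rw [Pi.single_eq_of_ne (fun h => hj (Fin.ext (Fin.mk.inj_iff.1 h))), map_zero]
    · rfl

theorem absInf_det_stepGL_one [Fintype Fq] {s : ℕ} (hs : s - 1 ≤ n) :
    absInf (stepGL Fq n 1).val.det =
      (Fintype.card Fq : ℝ) ^ (s - 1) * absInf (stepGL Fq n s).val.det := by
  have h1 : (Fintype.card Fq : ℝ) ^ (s - 1) =
      ∏ i : Fin n, if (i : ℕ) < s - 1 then (Fintype.card Fq : ℝ) else 1 := by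
    rw [Finset.prod_ite, Finset.prod_const, Finset.prod_const_one, mul_one]
    congr 1
    rw [Fin.card_filter_val_lt, min_eq_right hs]
  rw [stepGL_one, stepGL, absInf_det_diagGL, absInf_det_diagGL, h1, ← Finset.prod_mul_distrib]
  refine Finset.prod_congr rfl fun i _ => ?_
  split_ifs <;> simp [absInf_tUnit, absInf_one]

end AdmissibleVectors

/-! ### Harmonicity on the Fourier side. -/

section HarmonicCoefficients

variable {p : ℕ} {Fq : Type*} [Field Fq] [Fintype Fq] [Algebra (ZMod p) Fq]
  {ψ₀ : AddChar (ZMod p) ℂ} {r : ℕ} {h : PInf Fq r → ℂ}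

theorem fourierCoeff_eq_latticeFourier (a : Fin (r - 1) → Fq[X])
    (y : GL (Fin (r - 1)) (FInf Fq)) :
    fourierCoeff ψ₀ h a y = latticeFourier ψ₀ (fun x => valueAt h x y) a := rfl

theorem IsDoubleCosetFunction.fourierCoeff_eq_zero [Fact p.Prime] (hψ₀ : ψ₀ ≠ 1)
    (hh : IsDoubleCosetFunction h) {a : Fin (r - 1) → Fq[X]} {y : GL (Fin (r - 1)) (FInf Fq)}
    (ha : ¬ Admissible a y) : fourierCoeff ψ₀ h a y = 0 := by
  rw [admissible_iff] at ha
  simp only [mem_piO, not_forall] at ha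
  obtain ⟨i, j, hj, hne⟩ := ha
  obtain ⟨c, hc⟩ := exists_psi_single_mul_ne_one hψ₀ hne
  -- Failure of admissibility gives `j ≤ 1`, so `π^{1-j}` is integral and yields a period of `h`
  -- that `ψ` detects.
  have hw : (Pi.single i (HahnSeries.single (1 - j) c) : Fin (r - 1) → FInf Fq) ∈
      polydisc Fq 0 (r - 1) := by
    refine mem_polydisc.2 fun i' => ?_
    by_cases h : i' = i
    · subst h
      rw [Pi.single_eq_same]
      exact piO_mono (by omega) (single_mem_piO _ c)
    · rw [Pi.single_eq_of_ne h]
      exact (piO Fq 0).zero_mem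
  refine latticeFourier_eq_zero ψ₀ (fun x β hβ => hh.valueAt_add_lattice x y hβ)
    (fun x => hh.valueAt_add_vecMul_inv x y hw) ?_
  rw [polyDot_vecMul_inv, Finset.sum_eq_single i]
  · rwa [Pi.single_eq_same, mul_comm]
  · intro i' _ h
    rw [Pi.single_eq_of_ne h, mul_zero]
  · simp

/-- Orthogonality on `𝔽_q^{s-1}`: against constants `u`, `ψ` sees only the coefficients of `π` in
the `c i`. -/
theorem sum_psi_extendConst [Fact p.Prime] (hψ₀ : ψ₀ ≠ 1) {n s : ℕ}
    (c : Fin n → FInf Fq) [Decidable (∀ i : Fin n, (i : ℕ) < s - 1 → (c i).coeff 1 = 0)] :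
    ∑ u : Fin (s - 1) → Fq, psi ψ₀ (∑ i, c i * extendConst u i) =
      if ∀ i : Fin n, (i : ℕ) < s - 1 → (c i).coeff 1 = 0
        then (Fintype.card Fq : ℂ) ^ (s - 1) else 0 := by
  classical
  let χ : AddChar (Fin (s - 1) → Fq) ℂ :=
    { toFun := fun u => psi ψ₀ (∑ i, c i * extendConst u i)
      map_zero_eq_one' := by simp [extendConst_zero, psi_zero]
      map_add_eq_mul' := fun u v => by
        simp only [extendConst_add, Pi.add_apply, mul_add, Finset.sum_add_distrib, psi_add] }
  have hχ_apply : ∀ u, χ u = psi ψ₀ (∑ i, c i * extendConst u i) := fun _ => rfl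
  have hχ : χ = 0 ↔ ∀ i : Fin n, (i : ℕ) < s - 1 → (c i).coeff 1 = 0 := by
    constructor
    · intro h i hi
      by_contra hne
      obtain ⟨d, hd⟩ := exists_psi_single_mul_ne_one hψ₀ hne
      refine hd ?_
      have h1 := hχ_apply (Pi.single ⟨i, hi⟩ d)
      rw [h, AddChar.zero_apply] at h1
      rw [h1, extendConst_single, Finset.sum_eq_single i]
      · rw [Pi.single_eq_same, mul_comm, sub_self, HahnSeries.C_apply]
      · intro j _ hj
        rw [Pi.single_eq_of_ne hj, mul_zero]
      · simp
    · intro h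
      refine DFunLike.ext _ _ fun u => ?_
      rw [hχ_apply, AddChar.zero_apply]
      refine psi_eq_one_of_coeff ψ₀ ?_
      rw [HahnSeries.coeff_sum]
      refine Finset.sum_eq_zero fun i _ => ?_
      rw [extendConst]
      split_ifs with hi
      · rw [coeff_mul_C, h i hi, mul_zero]
      · rw [mul_zero, HahnSeries.coeff_zero]
  simp only [← hχ_apply]
  rw [AddChar.sum_eq_ite]
  simp only [hχ]
  split_ifs <;> simp

/-- Harmonicity as a relation between Fourier coefficients. -/
theorem IsDoubleCosetFunction.isHarmonic_iff_fourierCoeff [Fact p.Prime] (hψ₀ : ψ₀ ≠ 1)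
    (hh : IsDoubleCosetFunction h) : IsHarmonic h ↔
      ∀ (a : Fin (r - 1) → Fq[X]) (y : GL (Fin (r - 1)) (FInf Fq)) (s : ℕ), 1 ≤ s → s ≤ r →
        Admissible a (y * stepGL Fq (r - 1) s) →
          (Fintype.card Fq : ℂ) ^ (s - 1) * fourierCoeff ψ₀ h a (y * stepGL Fq (r - 1) 1) =
            fourierCoeff ψ₀ h a (y * stepGL Fq (r - 1) s) := by
  classical
  have hper : ∀ {k : ℤ} {y : GL (Fin (r - 1)) (FInf Fq)} (t : Fin (r - 1) → FInf Fq),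
      IsPeriodic k (fun x => valueAt h x y) → IsPeriodic k (fun x => valueAt h (x + t) y) :=
    fun t H => ⟨fun x β hβ => by simpa only [add_right_comm] using H.1 (x + t) β hβ,
      fun x w hw => by simpa only [add_right_comm] using H.2 (x + t) w hw⟩
  have hsum : ∀ (a : Fin (r - 1) → Fq[X]) (y : GL (Fin (r - 1)) (FInf Fq)) (s : ℕ),
      latticeFourier ψ₀ (fun x => ∑ u : Fin (s - 1) → Fq,
        valueAt h (x + extendConst u ᵥ* (y⁻¹).val) (y * stepGL Fq (r - 1) 1)) a =
      (if ∀ i : Fin (r - 1), (i : ℕ) < s - 1 → (dualVec a y i).coeff 1 = 0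
        then (Fintype.card Fq : ℂ) ^ (s - 1) else 0) *
        fourierCoeff ψ₀ h a (y * stepGL Fq (r - 1) 1) := by
    intro a y s
    obtain ⟨m, hm⟩ := hh.exists_isPeriodic (y * stepGL Fq (r - 1) 1)
    rw [latticeFourier_sum ψ₀ _ fun u _ => hper _ (hm m le_rfl),
      ← sum_psi_extendConst hψ₀, Finset.sum_mul]
    refine Finset.sum_congr rfl fun u _ => ?_
    rw [← polyDot_vecMul_inv]
    exact latticeFourier_add_right ψ₀ (f := fun x => valueAt h x (y * stepGL Fq (r - 1) 1))
      (hm m le_rfl).1 _ a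
  rw [isHarmonic_iff_valueAt]
  constructor
  · intro H a y s hs1 hs2 ha
    have h1 := hsum a y s
    simp only [H _ y s hs1 hs2] at h1
    rw [if_pos (admissible_mul_stepGL_iff.1 ha).2] at h1
    exact h1.symm
  · intro H x y s hs1 hs2
    obtain ⟨m, hm⟩ := hh.exists_isPeriodic (y * stepGL Fq (r - 1) 1)
    obtain ⟨m', hm'⟩ := hh.exists_isPeriodic (y * stepGL Fq (r - 1) s)
    have hk := fun t => hper t (hm ((m + m' : ℕ) + 1) (by push_cast; omega))
    have hf : IsPeriodic (((m + m' : ℕ) : ℤ) + 1) (fun x => ∑ u : Fin (s - 1) → Fq,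
        valueAt h (x + extendConst u ᵥ* (y⁻¹).val) (y * stepGL Fq (r - 1) 1)) :=
      ⟨fun x β hβ => Finset.sum_congr rfl fun u _ => (hk _).1 x β hβ,
        fun x w hw => Finset.sum_congr rfl fun u _ => (hk _).2 x w hw⟩
    -- Both sides are periodic at the common level `m + m' + 1`, so comparing Fourier coefficients
    -- suffices.
    refine congr_fun (IsPeriodic.ext hψ₀ hf (hm' _ (by push_cast; omega)) fun a => ?_) x
    rw [hsum a y s, ← fourierCoeff_eq_latticeFourier]
    by_cases ha : Admissible a (y * stepGL Fq (r - 1) s)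
    · rw [if_pos (admissible_mul_stepGL_iff.1 ha).2, H a y s hs1 hs2 ha]
    -- For frequencies not admissible for `y t_s` the right side vanishes. On the left, either the
    -- character sum is zero or `a` is already inadmissible for `y t_1`.
    · rw [hh.fourierCoeff_eq_zero hψ₀ ha]
      by_cases ha1 : Admissible a (y * stepGL Fq (r - 1) 1)
      · rw [if_neg fun hc => ha (admissible_mul_stepGL_iff.2
          ⟨(admissible_mul_stepGL_iff.1 ha1).1, hc⟩), zero_mul]
      · rw [hh.fourierCoeff_eq_zero hψ₀ ha1, mul_zero]

end HarmonicCoefficients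

/-! ### Multiplication by `T`, and bounds for admissibility. -/

section Scaling

variable {Fq : Type*} [Field Fq] {n : ℕ}

theorem stepGL_one_commute (y : GL (Fin n) (FInf Fq)) : Commute (stepGL Fq n 1) y := by
  refine Units.ext ?_
  rw [stepGL_one, Units.val_mul, Units.val_mul]
  ext i j : 1
  simp only [diagGL, Matrix.diagonal_mul, Matrix.mul_diagonal]
  rw [mul_comm]

theorem stepGL_eq_one {s : ℕ} (hs : n ≤ s - 1) : stepGL Fq n s = 1 := by
  rw [stepGL, ← diagGL_one]
  congr 1
  funext i
  rw [if_pos (i.2.trans_le hs), Pi.one_apply]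

/-- Exhibits the matrix with a single `T` as a quotient of consecutive `t_s`, which brings
`subgroup_eq_top` within reach of harmonicity. -/
theorem diagGL_mulSingle_mul_stepGL (i : Fin n) :
    diagGL (Pi.mulSingle i (tUnit Fq)) * stepGL Fq n (i + 2) = stepGL Fq n (i + 1) := by
  rw [stepGL, stepGL, ← diagGL_mul]
  congr 1
  funext j
  rw [Pi.mul_apply]
  by_cases hj : j = i
  · subst hj
    simp
  · have : (j : ℕ) ≠ i := fun h => hj (Fin.ext h)
    rw [Pi.mulSingle_eq_of_ne hj, one_mul]
    congr 1
    rw [eq_iff_iff]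
    omega

theorem dualVec_mul_stepGL_pow_mem {a : Fin n → Fq[X]} {y : GL (Fin n) (FInf Fq)} {k : ℤ}
    (h : ∀ i, dualVec a y i ∈ piO Fq k) (N : ℕ) (i : Fin n) :
    dualVec a (y * stepGL Fq n 1 ^ N) i ∈ piO Fq (k + N) := by
  induction N with
  | zero => simpa using h i
  | succ N ih =>
    rw [pow_succ, ← mul_assoc]
    nth_rewrite 2 [stepGL_one]
    rw [dualVec_mul_diagGL]
    have := mul_mem_piO ih tUnit_inv_mem_piO
    rwa [add_assoc] at this

theorem eventually_admissible {r : ℕ} (a : Fin (r - 1) → Fq[X]) (y : GL (Fin (r - 1)) (FInf Fq)) :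
    ∀ᶠ N in Filter.atTop, Admissible a (y * stepGL Fq (r - 1) 1 ^ N) := by
  choose k hk using fun i => exists_mem_piO (dualVec a y i)
  refine Filter.eventually_atTop.2 ⟨∑ i, k i + 2, fun N hN => admissible_iff.2 fun i => ?_⟩
  refine piO_mono ?_ (dualVec_mul_stepGL_pow_mem (k := -∑ i, (k i : ℤ)) (fun i => ?_) N i)
  · have : ((∑ i, k i : ℕ) : ℤ) = ∑ i, (k i : ℤ) := by push_cast; rfl
    omega
  · refine piO_mono (neg_le_neg ?_) (hk i)
    exact Finset.single_le_sum (f := fun i => (k i : ℤ)) (fun _ _ => by positivity)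
      (Finset.mem_univ i)

/-- Dividing `a_i` by `T^{deg a_i + 2}` leaves order at least `2`, which explains the exponents
`α_i`. -/
theorem admissible_yOf {r : ℕ} (a : Fin (r - 1) → Fq[X]) : Admissible a (yOf a) := by
  refine admissible_iff.2 fun i => ?_
  have h1 : dualVec a 1 i = polyEmb Fq (a i) := by simp [dualVec]
  rw [yOf, ← one_mul (diagGL _), dualVec_mul_diagGL, h1, ← zpow_natCast, ← zpow_neg,
    tUnit_zpow_val, neg_neg]
  refine piO_mono ?_ (mul_mem_piO (polyEmb_mem_piO_of_degree_lt (m := (a i).natDegree + 1) ?_)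
    (single_mem_piO _ 1))
  · push_cast
    have := le_max_right (2 : ℤ) ((a i).natDegree + 2)
    omega
  · exact degree_le_natDegree.trans_lt (by exact_mod_cast Nat.lt_succ_self _)

/-- The admissible vectors for `y` have bounded degree. -/
theorem exists_forall_admissible_mem_polyBox {r : ℕ} (y : GL (Fin (r - 1)) (FInf Fq)) :
    ∃ m : ℕ, ∀ a, Admissible a y → ∀ i, (a i).degree < m := by
  obtain ⟨k, hk⟩ := exists_forall_mem_piO y.valᵀ
  refine ⟨k, fun a ha i => (degree_lt_iff_coeff_zero _ _).2 fun j hj => ?_⟩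
  have h1 : dualVec a y ᵥ* y.valᵀ = fun i => polyEmb Fq (a i) := by
    rw [dualVec, Matrix.vecMul_vecMul, ← Matrix.transpose_mul, ← Units.val_mul, mul_inv_cancel,
      Units.val_one, Matrix.transpose_one, Matrix.vecMul_one]
  -- Recovering `a` as `dualVec a y` times `yᵗ` puts its entries in `π^{2-k} O_∞`, so no `T^j` with
  -- `j ≥ k` occurs.
  have h2 := mem_polydisc.1 (vecMul_mem_polydisc (mem_polydisc.2 (admissible_iff.1 ha)) hk) i
  rw [h1] at h2
  have h3 := h2 (-(j : ℤ)) (by omega)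
  rw [coeff_polyEmb, if_pos (by omega)] at h3
  simpa using h3

end Scaling

/-! ### Constancy of the normalized coefficient, and the expansion. -/

section Main

variable {p : ℕ} {Fq : Type*} [Field Fq] [Fintype Fq] [Algebra (ZMod p) Fq]
  {ψ₀ : AddChar (ZMod p) ℂ} {r : ℕ} {h : PInf Fq r → ℂ}

variable (ψ₀ h) in
/-- The normalized coefficient `|det y| h^*(a, y)`. -/
def scaledCoeff (a : Fin (r - 1) → Fq[X]) (y : GL (Fin (r - 1)) (FInf Fq)) : ℂ :=
  (absInf y.val.det : ℂ) * fourierCoeff ψ₀ h a y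

theorem IsDoubleCosetFunction.scaledCoeff_mul_integralGL (hh : IsDoubleCosetFunction h)
    (a : Fin (r - 1) → Fq[X]) (y : GL (Fin (r - 1)) (FInf Fq))
    (κ : GL (Fin (r - 1)) (PowerSeries Fq)) :
    scaledCoeff ψ₀ h a (y * integralGL κ) = scaledCoeff ψ₀ h a y := by
  rw [scaledCoeff, scaledCoeff, absInf_det_mul, absInf_det_integralGL, mul_one]
  simp only [fourierCoeff, hh.valueAt_mul_integralGL]

/-- The factor `q^{s-1}` is the ratio of `|det t_1|` to `|det t_s|`, so the normalization absorbs
it. -/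
theorem IsDoubleCosetFunction.isHarmonic_iff_scaledCoeff [Fact p.Prime] (hψ₀ : ψ₀ ≠ 1)
    (hh : IsDoubleCosetFunction h) : IsHarmonic h ↔
      ∀ (a : Fin (r - 1) → Fq[X]) (y : GL (Fin (r - 1)) (FInf Fq)) (s : ℕ), 1 ≤ s → s ≤ r →
        Admissible a (y * stepGL Fq (r - 1) s) →
          scaledCoeff ψ₀ h a (y * stepGL Fq (r - 1) 1) =
            scaledCoeff ψ₀ h a (y * stepGL Fq (r - 1) s) := by
  rw [hh.isHarmonic_iff_fourierCoeff hψ₀]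
  refine forall_congr' fun a => forall_congr' fun y => forall_congr' fun s =>
    forall_congr' fun _ => forall_congr' fun hs => forall_congr' fun _ => ?_
  have h1 : absInf (y * stepGL Fq (r - 1) 1).val.det =
      (Fintype.card Fq : ℝ) ^ (s - 1) * absInf (y * stepGL Fq (r - 1) s).val.det := by
    rw [absInf_det_mul, absInf_det_mul,
      absInf_det_stepGL_one (Fq := Fq) (Nat.sub_le_sub_right hs 1)]
    ring
  rw [scaledCoeff, scaledCoeff, h1, Complex.ofReal_mul, Complex.ofReal_pow, Complex.ofReal_natCast,
    mul_assoc, mul_left_comm]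
  exact (mul_right_inj' (Complex.ofReal_ne_zero.2 (absInf_det_ne_zero
    (y * stepGL Fq (r - 1) s)))).symm

/-- For harmonic `h` the normalized coefficient is constant on the admissible `y`. -/
theorem IsHarmonic.scaledCoeff_eq [Fact p.Prime] (hr : 1 ≤ r) (hψ₀ : ψ₀ ≠ 1)
    (hh : IsDoubleCosetFunction h) (H : IsHarmonic h) {a : Fin (r - 1) → Fq[X]}
    {y y' : GL (Fin (r - 1)) (FInf Fq)} (hy : Admissible a y) (hy' : Admissible a y') :
    scaledCoeff ψ₀ h a y = scaledCoeff ψ₀ h a y' := by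
  rw [hh.isHarmonic_iff_scaledCoeff hψ₀] at H
  let t := stepGL Fq (r - 1) 1
  -- This is the relation for `s = r`, where `t_s` is the identity.
  have hstep : ∀ y, Admissible a y → scaledCoeff ψ₀ h a (y * t) = scaledCoeff ψ₀ h a y := by
    intro y hy
    have := H a y r hr le_rfl (hy.mul_stepGL r)
    rwa [stepGL_eq_one (s := r) le_rfl, mul_one] at this
  have hpow : ∀ y, Admissible a y → ∀ N : ℕ,
      scaledCoeff ψ₀ h a (y * t ^ N) = scaledCoeff ψ₀ h a y := by
    intro y hy N
    have hadm : ∀ N : ℕ, Admissible a (y * t ^ N) := by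
      intro N
      induction N with
      | zero => simpa using hy
      | succ N ih =>
        rw [pow_succ, ← mul_assoc]
        exact ih.mul_stepGL 1
    induction N with
    | zero => simp
    | succ N ih => rw [pow_succ, ← mul_assoc, hstep _ (hadm N), ih]
  -- Admissibility is not preserved by general `z`, so equality is asked only for large `N`;
  -- quantifying over all `y` makes these `z` a group.
  let G : Subgroup (GL (Fin (r - 1)) (FInf Fq)) :=
    { carrier := {z | ∀ y, ∀ᶠ N in Filter.atTop,
        scaledCoeff ψ₀ h a (y * z * t ^ N) = scaledCoeff ψ₀ h a (y * t ^ N)}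
      one_mem' := fun y => by simp
      mul_mem' := fun {z z'} hz hz' y => by
        filter_upwards [hz y, hz' (y * z)] with N h1 h2
        rw [← mul_assoc, h2, h1]
      inv_mem' := fun {z} hz y => by
        filter_upwards [hz (y * z⁻¹)] with N h1
        rw [← h1, inv_mul_cancel_right] }
  have hcomm : ∀ (y z) (N : ℕ), y * z * t ^ N = y * t ^ N * z := fun y z N => by
    rw [mul_assoc, mul_assoc, ((stepGL_one_commute z).pow_left N).eq]
  have hmem : ∀ s, 1 ≤ s → s ≤ r → stepGL Fq (r - 1) s ∈ G := by
    intro s hs1 hs2 y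
    filter_upwards [eventually_admissible a y] with N hN
    rw [hcomm, ← H a _ s hs1 hs2 (hN.mul_stepGL s)]
    exact hstep _ hN
  have htop : y⁻¹ * y' ∈ G := by
    refine subgroup_eq_top G (fun κ y => Filter.Eventually.of_forall fun N => ?_) (fun i => ?_) _
    · rw [hcomm, hh.scaledCoeff_mul_integralGL]
    -- The indices `i + 1` and `i + 2` stay within `1 ≤ s ≤ r` because `i < r - 1`.
    · rw [eq_mul_inv_of_mul_eq (diagGL_mulSingle_mul_stepGL i)]
      exact G.mul_mem (hmem _ (by omega) (by omega)) (G.inv_mem (hmem _ (by omega) (by omega)))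
  -- One such `N` suffices: `hpow` strips `T^N` from both sides, as `y` and `y'` are themselves
  -- admissible.
  obtain ⟨N, hN⟩ := (htop y).exists
  rw [mul_inv_cancel_left, hpow y' hy', hpow y hy] at hN
  exact hN.symm

theorem smul_cCoeff (hr : 1 ≤ r) (a : Fin (r - 1) → Fq[X]) (y : GL (Fin (r - 1)) (FInf Fq)) :
    ((absInf y.val.det)⁻¹ : ℝ) * (Fintype.card Fq : ℂ) ^ (2 * (r - 1)) * cCoeff ψ₀ h a =
      (absInf y.val.det : ℂ)⁻¹ * scaledCoeff ψ₀ h a (yOf a) := by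
  have hq : (Fintype.card Fq : ℂ) ≠ 0 := by exact_mod_cast Fintype.card_ne_zero
  have h1 : (Fintype.card Fq : ℂ) ^ (2 * (r - 1)) * (Fintype.card Fq : ℂ) ^ (2 * (1 - (r : ℤ))) =
      1 := by
    rw [← zpow_natCast, ← zpow_add₀ hq]
    push_cast [hr]
    ring_nf
    simp
  rw [cCoeff, scaledCoeff, Complex.ofReal_inv]
  linear_combination ((absInf y.val.det : ℂ)⁻¹ * (absInf (yOf a).val.det : ℂ) *
    fourierCoeff ψ₀ h a (yOf a)) * h1

theorem fourierCoeff_eq_iff (hr : 1 ≤ r) (a : Fin (r - 1) → Fq[X])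
    (y : GL (Fin (r - 1)) (FInf Fq)) :
    fourierCoeff ψ₀ h a y = ((absInf y.val.det)⁻¹ : ℝ) *
        (Fintype.card Fq : ℂ) ^ (2 * (r - 1)) * cCoeff ψ₀ h a ↔
      scaledCoeff ψ₀ h a y = scaledCoeff ψ₀ h a (yOf a) := by
  have hne : (absInf y.val.det : ℂ) ≠ 0 := Complex.ofReal_ne_zero.2 (absInf_det_ne_zero y)
  rw [smul_cCoeff hr, eq_inv_mul_iff_mul_eq₀ hne]
  rfl

theorem IsDoubleCosetFunction.isHarmonic_iff [Fact p.Prime] (hr : 1 ≤ r) (hψ₀ : ψ₀ ≠ 1)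
    (hh : IsDoubleCosetFunction h) : IsHarmonic h ↔
      ∀ (y : GL (Fin (r - 1)) (FInf Fq)) (a : Fin (r - 1) → Fq[X]), Admissible a y →
        fourierCoeff ψ₀ h a y = ((absInf y.val.det)⁻¹ : ℝ) *
          (Fintype.card Fq : ℂ) ^ (2 * (r - 1)) * cCoeff ψ₀ h a := by
  simp only [fourierCoeff_eq_iff hr]
  refine ⟨fun H y a ha => H.scaledCoeff_eq hr hψ₀ hh ha (admissible_yOf a), fun H => ?_⟩
  refine (hh.isHarmonic_iff_scaledCoeff hψ₀).2 fun a y s _ _ ha => ?_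
  rw [H _ a ha, H _ a ha.mul_stepGL_one]

theorem finite_admissible (y : GL (Fin (r - 1)) (FInf Fq)) :
    {a : Fin (r - 1) → Fq[X] | Admissible a y}.Finite := by
  obtain ⟨m, hm⟩ := exists_forall_admissible_mem_polyBox y
  exact (@Set.toFinite _ (polyBox Fq (r - 1) m : Set (Fin (r - 1) → Fq[X]))
    (instFinitePolyBox m)).subset hm

/-- The Fourier expansion of a function on `Γ_∞ \ P(F_∞) / P(O_∞)`. -/
theorem IsDoubleCosetFunction.valueAt_eq_finsum [Fact p.Prime] (hψ₀ : ψ₀ ≠ 1)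
    (hh : IsDoubleCosetFunction h) (x : Fin (r - 1) → FInf Fq) (y : GL (Fin (r - 1)) (FInf Fq)) :
    valueAt h x y = ∑ᶠ a ∈ {a : Fin (r - 1) → Fq[X] | Admissible a y},
      fourierCoeff ψ₀ h a y * psi ψ₀ (polyDot a x) := by
  obtain ⟨m, hm⟩ := exists_forall_admissible_mem_polyBox y
  obtain ⟨m', hm'⟩ := hh.exists_isPeriodic y
  have h1 := (hm' (((m + m' : ℕ) : ℤ) + 1) (by push_cast; omega)).fourier_inversion hψ₀ x
  rw [h1, ← finsum_eq_sum_of_fintype]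
  refine (finsum_set_coe_eq_finsum_mem (polyBox Fq (r - 1) (m + m') : Set (Fin (r - 1) → Fq[X]))
    (f := fun a => fourierCoeff ψ₀ h a y * psi ψ₀ (polyDot a x))).trans ?_
  -- The box contains every admissible vector, and inadmissible ones contribute zero.
  refine finsum_mem_inter_support_eq' _ _ _ fun a ha => ?_
  have hadm : Admissible a y := by
    by_contra hc
    exact ha (by simp [hh.fourierCoeff_eq_zero hψ₀ hc])
  refine ⟨fun _ => hadm, fun _ i => (hm a hadm i).trans_le ?_⟩
  exact_mod_cast Nat.le_add_right m m'

end Main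

end DrinfeldFourier

end

theorem mainTheorem9 {p : ℕ} [Fact p.Prime] {Fq : Type*} [Field Fq] [Fintype Fq]
    [Algebra (ZMod p) Fq] (ψ₀ : AddChar (ZMod p) ℂ) (hψ₀ : ψ₀ ≠ 1)
    (r : ℕ) (hr : 2 ≤ r) (h : DrinfeldFourier.PInf Fq r → ℂ)
    (hh : DrinfeldFourier.IsDoubleCosetFunction h) :
    (DrinfeldFourier.IsHarmonic h ↔
      ∀ (y : GL (Fin (r - 1)) (DrinfeldFourier.FInf Fq)) (a : Fin (r - 1) → Polynomial Fq),
        DrinfeldFourier.Admissible a y →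
          DrinfeldFourier.fourierCoeff ψ₀ h a y =
            ((DrinfeldFourier.absInf y.val.det)⁻¹ : ℝ) * (Fintype.card Fq : ℂ) ^ (2 * (r - 1)) *
              DrinfeldFourier.cCoeff ψ₀ h a) ∧
    (DrinfeldFourier.IsHarmonic h →
      ∀ (y : GL (Fin (r - 1)) (DrinfeldFourier.FInf Fq)),
        {a : Fin (r - 1) → Polynomial Fq | DrinfeldFourier.Admissible a y}.Finite ∧
        ∀ x : Fin (r - 1) → DrinfeldFourier.FInf Fq,
          DrinfeldFourier.valueAt h x y =
            ((DrinfeldFourier.absInf y.val.det)⁻¹ : ℝ) * (Fintype.card Fq : ℂ) ^ (2 * (r - 1)) *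
              ∑ᶠ a ∈ {a : Fin (r - 1) → Polynomial Fq | DrinfeldFourier.Admissible a y},
                DrinfeldFourier.cCoeff ψ₀ h a *
                  DrinfeldFourier.psi ψ₀ (DrinfeldFourier.polyDot a x)) := by
  have hr1 : 1 ≤ r := by omega
  refine ⟨hh.isHarmonic_iff hr1 hψ₀, fun H y => ⟨DrinfeldFourier.finite_admissible y, fun x => ?_⟩⟩
  -- The expansion holds for every double coset function; harmonicity only rewrites its
  -- coefficients.
  rw [hh.valueAt_eq_finsum hψ₀ x y, mul_finsum_mem]
  refine finsum_mem_congr rfl fun a ha => ?_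
  rw [(hh.isHarmonic_iff hr1 hψ₀).1 H y a ha, mul_assoc]
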